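/- Let $k$ be a field, $S=k[x_1,\ldots,x_n]$ with its standard grading, and $\mathfrak M=(x_1,\ldots,x_n)$. For a finitely generated graded $S$-module $M$ put $$a_i(M)=\max\{d\in\mathbb Z \mid H^i_{\mathfrak M}(M)_d\neq 0\}\qquad(a_i(M)=-\infty \text{ if } H^i_{\mathfrak M}(M)=0),$$ where $H^i_{\mathfrak M}(M)$ is the $i$-th graded local cohomology module, and for $t\ge 0$ put $$\operatorname{reg}_t(M)=\max\{a_i(M)+i \mid 0\le i\le t\},\qquad a^*_t(M)=\max\{a_i(M)\mid 0\le i\le t\}.$$ A sequence $z_1,\ldots,z_s$ of homogeneous elements of $S/I$, for $I$ a homogeneous ideal, is called filter-regular if, for every $i=1,\ldots,s$, the element $z_i$ lies in no associated prime $\mathfrak p\neq\mathfrak m$ of $(z_1,\ldots,z_{i-1})$, where $\mathfrak m$ is the ideal of $S/I$ generated by the classes of $x_1,\ldots,x_n$. **Theorem.** Let $I\subseteq S$ be a homogeneous ideal, and let $\operatorname{in}(I)$ be its initial ideal with respect to the (degree) reverse lexicographic order with $x_1>\cdots>x_n$. Assume that (the classes of) $x_n,x_{n-1},\ldots,x_1$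 form a filter-regular sequence in $S/I$. Then for every integer $t\ge 0$: (i) $\operatorname{reg}_t(I)=\operatorname{reg}_t(\operatorname{in}(I))$ and $\operatorname{reg}_t(S/I)=\operatorname{reg}_t(S/\operatorname{in}(I))$; (ii) $a^*_t(I)=a^*_t(\operatorname{in}(I))$ and $a^*_t(S/I)=a^*_t(S/\operatorname{in}(I))$. -/

import Mathlib

open MvPolynomial

noncomputable section

namespace GradedLocalCohomology

/-- The reverse lexicographic (term) order on exponent vectors, with `x_1 > x_2 > ... > x_n`:
`RevlexLT a b` means `x^a < x^b`, that is, `deg a < deg b`, or the degrees agree and at the last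
index where `a` and `b` differ the exponent in `a` is the larger one. -/
def RevlexLT {n : ℕ} (a b : Fin n →₀ ℕ) : Prop :=
  a.degree < b.degree ∨
    (a.degree = b.degree ∧ ∃ i, (∀ j, i < j → a j = b j) ∧ b i < a i)

/-- `x^a` is the initial monomial of `f`: it occurs in `f` and all the other monomials that
occur in `f` are smaller. -/
def IsInitialExponent {k : Type*} [Field k] {n : ℕ} (f : MvPolynomial (Fin n) k)
    (a : Fin n →₀ ℕ) : Prop :=
  a ∈ f.support ∧ ∀ b ∈ f.support, b ≠ a → RevlexLT b a

/-- The initial ideal of `I` with respect to the reverse lexicographic order: it is generated by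
the initial monomials of the (nonzero) elements of `I`. -/
def initialIdeal {k : Type*} [Field k] {n : ℕ} (I : Ideal (MvPolynomial (Fin n) k)) :
    Ideal (MvPolynomial (Fin n) k) :=
  Ideal.span {m | ∃ f ∈ I, ∃ a, IsInitialExponent f a ∧ m = monomial a 1}

/-- A sequence `z_1, ..., z_s` in a ring `R` with distinguished ideal `𝔪` is filter-regular if
`z_i` avoids every associated prime `𝔭 ≠ 𝔪` of the ideal `(z_1, ..., z_{i-1})`, for all `i`. -/
def IsFilterRegular {R : Type*} [CommRing R] (𝔪 : Ideal R) {s : ℕ} (z : Fin s → R) : Prop :=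
  ∀ i, ∀ 𝔭 ∈ associatedPrimes R (R ⧸ Ideal.span (z '' {j | j < i})), 𝔭 ≠ 𝔪 → z i ∉ 𝔭

/-- The maximal graded ideal of `S / I`, i.e. the ideal generated by the classes of the
variables. -/
def quotientMaximalIdeal {k : Type*} [Field k] {n : ℕ} (I : Ideal (MvPolynomial (Fin n) k)) :
    Ideal (MvPolynomial (Fin n) k ⧸ I) :=
  Ideal.span (Set.range fun i => Ideal.Quotient.mk I (X i))

/-- The natural grading on an ideal `I` of `S`. The degree `e` part consists of the elements of
`I` that are homogeneous of degree `e`. -/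
def idealGrading {k : Type*} [Field k] {n : ℕ} (I : Ideal (MvPolynomial (Fin n) k)) (e : ℕ) :
    AddSubgroup I :=
  (homogeneousSubmodule (Fin n) k e).toAddSubgroup.comap I.subtype.toAddMonoidHom

/-- The natural grading on the quotient `S / I`. The degree `e` part consists of the classes of
the homogeneous polynomials of degree `e`. -/
def quotientGrading {k : Type*} [Field k] {n : ℕ} (I : Ideal (MvPolynomial (Fin n) k)) (e : ℕ) :
    AddSubgroup (MvPolynomial (Fin n) k ⧸ I) :=
  (homogeneousSubmodule (Fin n) k e).toAddSubgroup.map (Ideal.Quotient.mk I).toAddMonoidHom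

/-- The multiplicative set of all monomials in the variables `x_j`, `j ∈ J`. -/
def variableMonoid (k : Type*) [Field k] {n : ℕ} (J : Finset (Fin n)) :
    Submonoid (MvPolynomial (Fin n) k) :=
  Submonoid.closure {f | ∃ j ∈ J, f = X j}

theorem variableMonoid_mono (k : Type*) [Field k] {n : ℕ} {J K : Finset (Fin n)} (h : J ⊆ K) :
    variableMonoid k J ≤ variableMonoid k K := by
  apply Submonoid.closure_mono
  rintro f ⟨j, hj, rfl⟩
  exact ⟨j, h hj, rfl⟩

section Cech

variable {k : Type*} [Field k] {n : ℕ} (M : Type*) [AddCommGroup M]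
  [Module (MvPolynomial (Fin n) k) M]

/-- The localization `M_{x_J}` of `M` at the product of the variables `x_j`, `j ∈ J`. -/
abbrev LocalizationAt (J : Finset (Fin n)) : Type _ :=
  LocalizedModule (variableMonoid k J) M

/-- The canonical map `M_{x_J} → M_{x_K}` for `J ⊆ K`. -/
def restriction {J K : Finset (Fin n)} (h : J ⊆ K) :
    LocalizationAt (k := k) M J →ₗ[MvPolynomial (Fin n) k] LocalizationAt (k := k) M K :=
  LocalizedModule.liftOfLE (variableMonoid k J) (variableMonoid k K) (variableMonoid_mono k h)

/-- The module underlying the Čech complex of `M` on `x_1, ..., x_n`, with all cohomological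
degrees put together: the direct sum of the `M_{x_J}`, `J ⊆ {1, ..., n}`.
The summands with `|J| = p` make up the term `C^p` of the complex. -/
abbrev CechModule : Type _ := ∀ J : Finset (Fin n), LocalizationAt (k := k) M J

/-- The Čech differential,
`(D φ)_J = ∑_{j ∈ J} (-1)^{#{i ∈ J | i < j}} φ_{J \ {j}}|_{M_{x_J}}`. It maps `C^p` to `C^{p+1}`. -/
def cechDifferential :
    CechModule (k := k) (n := n) M →ₗ[MvPolynomial (Fin n) k] CechModule (k := k) (n := n) M :=
  LinearMap.pi fun J => ∑ j ∈ J, (-1 : MvPolynomial (Fin n) k) ^ (J.filter (· < j)).card •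
    (restriction M (J.erase_subset j)) ∘ₗ LinearMap.proj (J.erase j)

/-- The cohomology `ker D / im D` of the Čech complex, with all cohomological degrees put
together: the direct sum of all local cohomology modules of `M` with respect to
`(x_1, ..., x_n)`. -/
abbrev TotalLocalCohomology : Type _ :=
  LinearMap.ker (cechDifferential (k := k) (n := n) M) ⧸
    (LinearMap.range (cechDifferential (k := k) (n := n) M)).submoduleOf
      (LinearMap.ker (cechDifferential (k := k) (n := n) M))

variable {M} (𝓜 : ℕ → AddSubgroup M)

/-- The degree `d` part of `M_{x_J}`, for a graded module `M` whose degree `e` part is `𝓜 e`: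
it is generated by the fractions `m / s` where `m` is homogeneous of degree `e`, where `s` is a
monomial, and where `e - deg s = d`. -/
def localizationGrading (J : Finset (Fin n)) (d : ℤ) :
    AddSubgroup (LocalizationAt (k := k) M J) :=
  AddSubgroup.closure {z | ∃ (e : ℕ) (m : M) (s : variableMonoid k J), m ∈ 𝓜 e ∧
    (e : ℤ) - (s : MvPolynomial (Fin n) k).totalDegree = d ∧ z = LocalizedModule.mk m s}

/-- The degree `d` part of the term `C^p` of the Čech complex. -/
def cechCochains (p : ℕ) (d : ℤ) : AddSubgroup (CechModule (k := k) (n := n) M) where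
  carrier := {φ | ∀ J, φ J ∈ localizationGrading 𝓜 J d ∧ (J.card ≠ p → φ J = 0)}
  zero_mem' := fun J => ⟨zero_mem _, fun _ => rfl⟩
  add_mem' := fun {φ ψ} hφ hψ J => ⟨add_mem (hφ J).1 (hψ J).1, fun h => by
    rw [Pi.add_apply, (hφ J).2 h, (hψ J).2 h, add_zero]⟩
  neg_mem' := fun {φ} hφ J => ⟨neg_mem (hφ J).1, fun h => by
    rw [Pi.neg_apply, (hφ J).2 h, neg_zero]⟩

/-- The degree `d` part `H^p(M)_d` of the `p`-th local cohomology module of the graded module `M`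
with respect to the maximal graded ideal `(x_1, ..., x_n)`: the classes of the cocycles in
`(C^p)_d`. -/
def localCohomologyPart (p : ℕ) (d : ℤ) :
    AddSubgroup (TotalLocalCohomology (k := k) (n := n) M) :=
  ((cechCochains (k := k) (n := n) 𝓜 p d).comap
      (LinearMap.ker (cechDifferential (k := k) (n := n) M)).subtype.toAddMonoidHom).map
    (Submodule.mkQ _).toAddMonoidHom

variable (k n)

/-- `a_i(M)`, the largest `d` with `H^i(M)_d ≠ 0`, and `-∞` if there is none. It is formed as a
supremum in `ℤ ∪ {-∞, +∞}`. -/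
def aInvariant (i : ℕ) : WithBot (WithTop ℤ) :=
  sSup {v | ∃ d : ℤ, localCohomologyPart (k := k) (n := n) 𝓜 i d ≠ ⊥ ∧ v = ((d : WithTop ℤ) : _)}

/-- `reg_t(M) = max {a_i(M) + i | i ≤ t}`. -/
def regT (t : ℕ) : WithBot (WithTop ℤ) :=
  (Finset.range (t + 1)).sup fun i => aInvariant k n 𝓜 i + (((i : ℤ) : WithTop ℤ) : _)

/-- `a*_t(M) = max {a_i(M) | i ≤ t}`. -/
def aStarT (t : ℕ) : WithBot (WithTop ℤ) :=
  (Finset.range (t + 1)).sup fun i => aInvariant k n 𝓜 i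

end Cech

end GradedLocalCohomology

end

attribute [local instance] MvPolynomial.gradedAlgebra

noncomputable section

namespace GradedLocalCohomology

/-! ### Localizations at sets of variables -/

section Localization

variable {k : Type*} [Field k] {n : ℕ}

/-! Both invariants depend only on the sets of degrees d with H^i(M)_d ≠ 0. `Dominates w` compares
the values d + w·i over i ≤ t; w = 1 gives reg_t and w = 0 gives a*_t. So for the quotients it
suffices that S/I and S/in(I) dominate each other for these two weights.

Let J_s be the sum of I and the ideal of the last s variables, and let x be the next variable.
Filter-regularity makes (J_s : x)/J_s torsion with respect to every variable. Such torsion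
disappears in every localization at a nonempty set of variables, so multiplication by x on S/J_s
yields the usual long exact sequence in positive cohomological degrees, as if x were a
nonzerodivisor. A class in H^{i+1}(S/J_s)_d is killed by a power of x, and its last nonzero multiple
comes from H^i(S/J_{s+1}) in a degree above d. Conversely, a degree of H^i(S/J_{s+1}) occurs in
H^i(S/J_s) or, lowered by one, in H^{i+1}(S/J_s). The top degree of H^0(S/J_s) is that of (J_s :
x)/J_s. Hence domination descends from s + 1 to s if the colon modules of the two ideals live in the
same degrees (`Dominates.of_sup_X`); at s = n the two ideals coincide.

The colon modules are compared by properties special to revlex: in(J_s) is in(I) plus the last s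
variables (`initialIdeal_sup_lastVariables`), and every monomial of in(J_s) : x is the initial
monomial of an element of J_s : x (`exists_mem_colon`). The torsion condition also passes to in(I)
in this way.

For the ideals themselves use 0 → I → S → S/I → 0, where H^i(S) = 0 for i ≠ n and H^n(S/I) = 0 for I
≠ 0 (`nonvanishingDegrees_top`). -/

theorem X_mem_variableMonoid {J : Finset (Fin n)} {j : Fin n} (hj : j ∈ J) :
    (X j : MvPolynomial (Fin n) k) ∈ variableMonoid k J :=
  Submonoid.subset_closure ⟨j, hj, rfl⟩

theorem variableMonoid_ne_zero {J : Finset (Fin n)} {s : MvPolynomial (Fin n) k}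
    (hs : s ∈ variableMonoid k J) : s ≠ 0 := by
  induction hs using Submonoid.closure_induction with
  | mem x hx => obtain ⟨j, -, rfl⟩ := hx; exact X_ne_zero j
  | one => exact one_ne_zero
  | mul x y _ _ hx hy => exact mul_ne_zero hx hy

theorem totalDegree_mul_of_mem {J : Finset (Fin n)} (s t : variableMonoid k J) :
    ((s * t : variableMonoid k J) : MvPolynomial (Fin n) k).totalDegree =
      (s : MvPolynomial (Fin n) k).totalDegree + (t : MvPolynomial (Fin n) k).totalDegree :=
  totalDegree_mul_of_isDomain (variableMonoid_ne_zero s.2) (variableMonoid_ne_zero t.2)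

variable {M N : Type*} [AddCommGroup M] [Module (MvPolynomial (Fin n) k) M]
  [AddCommGroup N] [Module (MvPolynomial (Fin n) k) N]

@[simp]
theorem restriction_mk {J K : Finset (Fin n)} (h : J ⊆ K) (m : M) (s : variableMonoid k J) :
    restriction M h (LocalizedModule.mk m s) =
      LocalizedModule.mk m
        (⟨(s : MvPolynomial (Fin n) k), variableMonoid_mono k h s.2⟩ : variableMonoid k K) := by
  rw [restriction, IsLocalizedModule.mk_eq_mk', IsLocalizedModule.mk_eq_mk']
  exact IsLocalizedModule.liftOfLE_mk' ..

@[simp]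
theorem restriction_restriction {J K L : Finset (Fin n)} (h : J ⊆ K) (h' : K ⊆ L)
    (x : LocalizationAt (k := k) M J) :
    restriction M h' (restriction M h x) = restriction M (h.trans h') x := by
  induction x using LocalizedModule.induction_on with
  | h m s => simp

/-- The map on localizations induced by a linear map. -/
def localizationMap (f : M →ₗ[MvPolynomial (Fin n) k] N) (J : Finset (Fin n)) :
    LocalizationAt (k := k) M J →ₗ[MvPolynomial (Fin n) k] LocalizationAt (k := k) N J :=
  (LocalizedModule.map (variableMonoid k J) f).restrictScalars _

@[simp]
theorem localizationMap_mk (f : M →ₗ[MvPolynomial (Fin n) k] N) (J : Finset (Fin n)) (m : M)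
    (s : variableMonoid k J) :
    localizationMap f J (LocalizedModule.mk m s) = LocalizedModule.mk (f m) s :=
  LocalizedModule.map_mk ..

theorem localizationMap_restriction (f : M →ₗ[MvPolynomial (Fin n) k] N) {J K : Finset (Fin n)}
    (h : J ⊆ K) (x : LocalizationAt (k := k) M J) :
    localizationMap f K (restriction M h x) = restriction N h (localizationMap f J x) := by
  induction x using LocalizedModule.induction_on with
  | h m s => simp

theorem localization_mk_eq_zero {J : Finset (Fin n)} {m : M} {s : variableMonoid k J} :
    (LocalizedModule.mk m s : LocalizationAt (k := k) M J) = 0 ↔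
      ∃ u : variableMonoid k J, u • m = 0 := by
  rw [← LocalizedModule.zero_mk 1, LocalizedModule.mk_eq]
  constructor
  · rintro ⟨u, hu⟩
    exact ⟨u, by simpa using hu⟩
  · rintro ⟨u, hu⟩
    exact ⟨u, by simpa using hu⟩

theorem localizationMap_surjective {f : M →ₗ[MvPolynomial (Fin n) k] N}
    (hf : Function.Surjective f) (J : Finset (Fin n)) :
    Function.Surjective (localizationMap f J) :=
  LocalizedModule.map_surjective _ f hf

theorem localizationMap_exact {P : Type*} [AddCommGroup P] [Module (MvPolynomial (Fin n) k) P]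
    {f : M →ₗ[MvPolynomial (Fin n) k] N} {g : N →ₗ[MvPolynomial (Fin n) k] P}
    (h : Function.Exact f g) (J : Finset (Fin n)) :
    Function.Exact (localizationMap f J) (localizationMap g J) :=
  LocalizedModule.map_exact (variableMonoid k J) f g h

/-- If every element of the kernel of `f` is killed by a power of each variable, then `f` becomes
injective in every proper localization. -/
theorem localizationMap_injective {f : M →ₗ[MvPolynomial (Fin n) k] N}
    (hf : ∀ m, f m = 0 → ∀ j, ∃ r : ℕ, (X j ^ r : MvPolynomial (Fin n) k) • m = 0)
    {J : Finset (Fin n)} (hJ : J.Nonempty) {x : LocalizationAt (k := k) M J}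
    (hx : localizationMap f J x = 0) : x = 0 := by
  induction x using LocalizedModule.induction_on with
  | h m s =>
    rw [localizationMap_mk, localization_mk_eq_zero] at hx
    obtain ⟨u, hu⟩ := hx
    obtain ⟨j, hj⟩ := hJ
    obtain ⟨r, hr⟩ := hf ((u : MvPolynomial (Fin n) k) • m) (by rw [map_smul]; exact hu) j
    refine localization_mk_eq_zero.2 ⟨⟨X j, X_mem_variableMonoid hj⟩ ^ r * u, ?_⟩
    rw [mul_smul]
    exact hr

/-- After multiplication by a power of `x_j`, every element of `M_{x_K}` comes from
`M_{x_{K \ j}}`. -/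
theorem exists_restriction_erase {K : Finset (Fin n)} (j : Fin n)
    (x : LocalizationAt (k := k) M K) :
    ∃ r₀ : ℕ, ∀ r, r₀ ≤ r → ∃ y : LocalizationAt (k := k) M (K.erase j),
      restriction M (K.erase_subset j) y = (X j ^ r : MvPolynomial (Fin n) k) • x := by
  suffices H : ∃ r : ℕ, ∃ y : LocalizationAt (k := k) M (K.erase j),
      restriction M (K.erase_subset j) y = (X j ^ r : MvPolynomial (Fin n) k) • x by
    obtain ⟨r₀, y, hy⟩ := H
    refine ⟨r₀, fun r hr => ⟨(X j ^ (r - r₀) : MvPolynomial (Fin n) k) • y, ?_⟩⟩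
    rw [map_smul, hy, smul_smul, ← pow_add, Nat.sub_add_cancel hr]
  by_cases hj : j ∈ K
  swap
  · refine ⟨0, restriction M (Finset.erase_eq_of_notMem hj).ge x, ?_⟩
    rw [restriction_restriction, pow_zero, one_smul]
    induction x using LocalizedModule.induction_on with
    | h m s => simp
  induction x using LocalizedModule.induction_on with
  | h m s =>
    obtain ⟨s, hs⟩ := s
    have key : ∃ r : ℕ, ∃ t ∈ variableMonoid k (K.erase j), s = X j ^ r * t := by
      induction hs using Submonoid.closure_induction with
      | mem x hx =>
        obtain ⟨i, hi, rfl⟩ := hx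
        by_cases hij : i = j
        · subst hij; exact ⟨1, 1, one_mem _, by simp⟩
        · exact ⟨0, X i, X_mem_variableMonoid (Finset.mem_erase.2 ⟨hij, hi⟩), by simp⟩
      | one => exact ⟨0, 1, one_mem _, by simp⟩
      | mul x y _ _ hx hy =>
        obtain ⟨r, t, ht, rfl⟩ := hx
        obtain ⟨r', t', ht', rfl⟩ := hy
        exact ⟨r + r', t * t', mul_mem ht ht', by ring⟩
    obtain ⟨r, t, ht, rfl⟩ := key
    refine ⟨r, LocalizedModule.mk m ⟨t, ht⟩, ?_⟩
    rw [restriction_mk, LocalizedModule.smul'_mk, LocalizedModule.mk_eq]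
    refine ⟨1, ?_⟩
    simp only [one_smul, Submonoid.smul_def, smul_smul]
    congr 1
    ring

/-- The kernel of `M_{x_K} → M_{x_{K ∪ j}}` is `x_j`-torsion. -/
theorem exists_pow_smul_eq_zero_of_restriction {K : Finset (Fin n)} {j : Fin n}
    {x : LocalizationAt (k := k) M K} (hx : restriction M (Finset.subset_insert j K) x = 0) :
    ∃ r₀ : ℕ, ∀ r, r₀ ≤ r → (X j ^ r : MvPolynomial (Fin n) k) • x = 0 := by
  suffices H : ∃ r : ℕ, (X j ^ r : MvPolynomial (Fin n) k) • x = 0 by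
    obtain ⟨r₀, h⟩ := H
    refine ⟨r₀, fun r hr => ?_⟩
    rw [← Nat.sub_add_cancel hr, pow_add, mul_smul, h, smul_zero]
  induction x using LocalizedModule.induction_on with
  | h m s =>
    rw [restriction_mk, localization_mk_eq_zero] at hx
    obtain ⟨⟨u, hu⟩, h⟩ := hx
    have key : ∃ r : ℕ, ∃ t ∈ variableMonoid k K, u = t * X j ^ r := by
      clear h
      induction hu using Submonoid.closure_induction with
      | mem x hx =>
        obtain ⟨i, hi, rfl⟩ := hx
        rcases Finset.mem_insert.1 hi with rfl | hi
        · exact ⟨1, 1, one_mem _, by simp⟩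
        · exact ⟨0, X i, X_mem_variableMonoid hi, by simp⟩
      | one => exact ⟨0, 1, one_mem _, by simp⟩
      | mul x y _ _ hx hy =>
        obtain ⟨r, t, ht, rfl⟩ := hx
        obtain ⟨r', t', ht', rfl⟩ := hy
        exact ⟨r + r', t * t', mul_mem ht ht', by ring⟩
    obtain ⟨r, t, ht, rfl⟩ := key
    refine ⟨r, ?_⟩
    rw [LocalizedModule.smul'_mk, localization_mk_eq_zero]
    refine ⟨⟨t, ht⟩, ?_⟩
    rw [Submonoid.smul_def, smul_smul]
    exact h

end Localization

/-! ### Gradings on localizations and on the Čech complex -/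

section Grading

variable {k : Type*} [Field k] {n : ℕ}

variable (k n) in
/-- A grading on an `S`-module given by the projections to its homogeneous components. The
components of negative degree are zero. -/
structure GradingProjections {M : Type*} [AddCommGroup M] [Module (MvPolynomial (Fin n) k) M]
    (𝓜 : ℕ → AddSubgroup M) where
  /-- the projection to the component of degree `e` -/
  proj : ℤ → M →+ M
  mem_iff : ∀ (e : ℕ) m, m ∈ 𝓜 e ↔ proj e m = m
  proj_proj : ∀ e m, proj e (proj e m) = proj e m
  proj_neg : ∀ e < 0, ∀ m, proj e m = 0
  proj_X_smul : ∀ e (i : Fin n) m,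
    proj (e + 1) ((X i : MvPolynomial (Fin n) k) • m) = (X i : MvPolynomial (Fin n) k) • proj e m

variable {M N : Type*} [AddCommGroup M] [Module (MvPolynomial (Fin n) k) M]
  [AddCommGroup N] [Module (MvPolynomial (Fin n) k) N]
  {𝓜 : ℕ → AddSubgroup M} {𝓝 : ℕ → AddSubgroup N}

namespace GradingProjections

variable (P : GradingProjections k n 𝓜) (Q : GradingProjections k n 𝓝)

theorem proj_smul {J : Finset (Fin n)} (e : ℤ) (s : variableMonoid k J) (m : M) :
    P.proj (e + (s : MvPolynomial (Fin n) k).totalDegree) (s • m) = s • P.proj e m := by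
  obtain ⟨s, hs⟩ := s
  simp only [Submonoid.smul_def]
  induction hs using Submonoid.closure_induction generalizing e m with
  | mem x hx =>
    obtain ⟨j, -, rfl⟩ := hx
    simpa using P.proj_X_smul e j m
  | one => simp
  | mul x y hx hy ihx ihy =>
    rw [totalDegree_mul_of_isDomain (variableMonoid_ne_zero hx) (variableMonoid_ne_zero hy),
      mul_smul, mul_smul, ← ihy, ← ihx]
    congr 2
    push_cast
    ring

/-- The projection of `M_{x_J}` to its component of degree `d`. -/
def locProj (J : Finset (Fin n)) (d : ℤ) :
    LocalizationAt (k := k) M J →+ LocalizationAt (k := k) M J where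
  toFun x := x.liftOn
    (fun ms => LocalizedModule.mk
      (P.proj (d + (ms.2 : MvPolynomial (Fin n) k).totalDegree) ms.1) ms.2) (by
    rintro ⟨m, s⟩ ⟨m', s'⟩ ⟨u, hu⟩
    refine LocalizedModule.mk_eq.2 ⟨u, ?_⟩
    simp only at hu ⊢
    -- Moving the scalars inside the projections turns both sides into projections of the same
    -- element, in degree d + deg s + deg s' + deg u.
    rw [← P.proj_smul, ← P.proj_smul, ← P.proj_smul, ← P.proj_smul, hu]
    congr 2
    ring)
  map_zero' := by
    rw [← LocalizedModule.zero_mk 1, LocalizedModule.liftOn_mk, map_zero]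
  map_add' x y := by
    induction x using LocalizedModule.induction_on with
    | h m s =>
    induction y using LocalizedModule.induction_on with
    | h m' s' =>
      rw [LocalizedModule.mk_add_mk, LocalizedModule.liftOn_mk, LocalizedModule.liftOn_mk,
        LocalizedModule.liftOn_mk, LocalizedModule.mk_add_mk, map_add, ← P.proj_smul,
        ← P.proj_smul]
      simp only [totalDegree_mul_of_mem]
      congr 3 <;> congr 1 <;> push_cast <;> ring

@[simp]
theorem locProj_mk (J : Finset (Fin n)) (d : ℤ) (m : M) (s : variableMonoid k J) :
    P.locProj J d (LocalizedModule.mk m s) =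
      LocalizedModule.mk (P.proj (d + (s : MvPolynomial (Fin n) k).totalDegree) m) s := rfl

@[simp]
theorem locProj_locProj (J : Finset (Fin n)) (d : ℤ) (x : LocalizationAt (k := k) M J) :
    P.locProj J d (P.locProj J d x) = P.locProj J d x := by
  induction x using LocalizedModule.induction_on with
  | h m s => simp [P.proj_proj]

/-- Replaces the generated subgroup by a fixed-point equation. The projection of a fraction is again
a generating fraction, or zero when its numerator would have negative degree. -/
theorem mem_localizationGrading_iff (J : Finset (Fin n)) (d : ℤ)
    (x : LocalizationAt (k := k) M J) :
    x ∈ localizationGrading 𝓜 J d ↔ P.locProj J d x = x := by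
  constructor
  · intro hx
    have : localizationGrading 𝓜 J d ≤ (P.locProj J d).eqLocus (AddMonoidHom.id _) := by
      refine (AddSubgroup.closure_le _).2 ?_
      rintro z ⟨e, m, s, hm, rfl, rfl⟩
      show P.locProj J _ _ = _
      rw [locProj_mk, sub_add_cancel, (P.mem_iff e m).1 hm]
      rfl
    exact this hx
  · intro hx
    rw [← hx]
    clear hx
    induction x using LocalizedModule.induction_on with
    | h m s =>
      rw [locProj_mk]
      rcases lt_or_ge (d + (s : MvPolynomial (Fin n) k).totalDegree) 0 with h | h
      · rw [P.proj_neg _ h, LocalizedModule.zero_mk]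
        exact zero_mem _
      · obtain ⟨e, he⟩ := Int.eq_ofNat_of_zero_le h
        refine AddSubgroup.subset_closure ⟨e, _, s, ?_, ?_, rfl⟩
        · rw [he, P.mem_iff, P.proj_proj]
        · rw [← he]; ring

theorem locProj_restriction {J K : Finset (Fin n)} (h : J ⊆ K) (d : ℤ)
    (x : LocalizationAt (k := k) M J) :
    P.locProj K d (restriction M h x) = restriction M h (P.locProj J d x) := by
  induction x using LocalizedModule.induction_on with
  | h m s => simp

/-- `f` is homogeneous of degree `c`. -/
def IsHomogeneousMap (f : M →ₗ[MvPolynomial (Fin n) k] N) (c : ℤ) : Prop :=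
  ∀ e m, Q.proj (e + c) (f m) = f (P.proj e m)

variable {P Q} in
theorem locProj_localizationMap {f : M →ₗ[MvPolynomial (Fin n) k] N} {c : ℤ}
    (hf : P.IsHomogeneousMap Q f c) (J : Finset (Fin n)) (d : ℤ)
    (x : LocalizationAt (k := k) M J) :
    Q.locProj J (d + c) (localizationMap f J x) = localizationMap f J (P.locProj J d x) := by
  induction x using LocalizedModule.induction_on with
  | h m s =>
    rw [localizationMap_mk, locProj_mk, locProj_mk, localizationMap_mk, ← hf, add_right_comm]

theorem isHomogeneousMap_X_smul (i : Fin n) :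
    P.IsHomogeneousMap P (LinearMap.lsmul _ _ (X i : MvPolynomial (Fin n) k)) 1 :=
  fun e m => P.proj_X_smul e i m

/-- The projection to the component of degree `d` of the `p`-th term of the Čech complex. -/
def cechProj (p d : ℤ) : CechModule (k := k) (n := n) M →+ CechModule (k := k) (n := n) M where
  toFun φ J := if (J.card : ℤ) = p then P.locProj J d (φ J) else 0
  map_zero' := by ext J; simp
  map_add' φ ψ := by
    ext J
    by_cases h : (J.card : ℤ) = p <;> simp [h]

theorem cechProj_apply (p d : ℤ) (φ : CechModule (k := k) (n := n) M) (J : Finset (Fin n)) :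
    P.cechProj p d φ J = if (J.card : ℤ) = p then P.locProj J d (φ J) else 0 := rfl

@[simp]
theorem cechProj_cechProj (p d : ℤ) (φ : CechModule (k := k) (n := n) M) :
    P.cechProj p d (P.cechProj p d φ) = P.cechProj p d φ := by
  ext J
  by_cases h : (J.card : ℤ) = p <;> simp [cechProj_apply, h]

theorem mem_cechCochains_iff (p : ℕ) (d : ℤ) (φ : CechModule (k := k) (n := n) M) :
    φ ∈ cechCochains 𝓜 p d ↔ P.cechProj p d φ = φ := by
  rw [funext_iff]
  refine forall_congr' fun J => ?_
  rw [P.mem_localizationGrading_iff, cechProj_apply]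
  by_cases h : J.card = p
  · simp [h]
  · simp only [Nat.cast_inj, h, if_false, ne_eq, not_false_eq_true, forall_true_left]
    exact ⟨fun h => h.2.symm, fun h => ⟨by rw [← h, map_zero], h.symm⟩⟩

end GradingProjections

theorem cechDifferential_apply (φ : CechModule (k := k) (n := n) M) (J : Finset (Fin n)) :
    cechDifferential M φ J = ∑ j ∈ J, (-1 : MvPolynomial (Fin n) k) ^ (J.filter (· < j)).card •
      restriction M (J.erase_subset j) (φ (J.erase j)) := by
  simp [cechDifferential]

/-- Lets primitives and lifts of homogeneous cochains be replaced by homogeneous ones. The integer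
index p allows C^{-1} = 0. -/
theorem GradingProjections.cechDifferential_cechProj (P : GradingProjections k n 𝓜) (p d : ℤ)
    (φ : CechModule (k := k) (n := n) M) :
    cechDifferential M (P.cechProj p d φ) = P.cechProj (p + 1) d (cechDifferential M φ) := by
  ext J
  rw [cechDifferential_apply, P.cechProj_apply]
  split_ifs with h
  · rw [cechDifferential_apply, map_sum]
    refine Finset.sum_congr rfl fun j hj => ?_
    have : ((J.erase j).card : ℤ) = p := by
      rw [Finset.cast_card_erase_of_mem hj, h]; ring
    rw [P.cechProj_apply, if_pos this, ← P.locProj_restriction]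
    rcases neg_one_pow_eq_or (MvPolynomial (Fin n) k) (J.filter (· < j)).card with h | h <;>
      simp [h]
  · refine Finset.sum_eq_zero fun j hj => ?_
    have : ¬ ((J.erase j).card : ℤ) = p := by
      rw [Finset.cast_card_erase_of_mem hj]; intro h'; apply h; rw [← h']; ring
    rw [P.cechProj_apply, if_neg this, map_zero, smul_zero]

end Grading

/-! ### Signs of the Čech differential -/

section Sign

variable {k : Type*} [Field k] {n : ℕ}

variable (k) in
/-- The sign of `j` in `J` in the Čech differential. -/
def cechSign (J : Finset (Fin n)) (j : Fin n) : MvPolynomial (Fin n) k :=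
  (-1) ^ (J.filter (· < j)).card

theorem cechSign_mul_self (J : Finset (Fin n)) (j : Fin n) :
    cechSign k J j * cechSign k J j = 1 := by
  rw [cechSign, ← mul_pow, neg_one_mul, neg_neg, one_pow]

theorem cechSign_erase_of_lt {J : Finset (Fin n)} {i j : Fin n} (hi : i ∈ J) (h : i < j) :
    cechSign k J j = - cechSign k (J.erase i) j := by
  have : (J.filter (· < j)).card = ((J.erase i).filter (· < j)).card + 1 := by
    rw [Finset.filter_erase, Finset.card_erase_add_one]
    simp [hi, h]
  rw [cechSign, this, pow_succ, cechSign]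
  ring

theorem cechSign_erase_of_le {J : Finset (Fin n)} {i j : Fin n} (h : j ≤ i) :
    cechSign k (J.erase i) j = cechSign k J j := by
  rw [cechSign, Finset.filter_erase, Finset.erase_eq_of_notMem, cechSign]
  simp [h]

/-- Deleting the smaller index flips the sign of the larger one, while deleting the larger leaves
the sign of the smaller unchanged. -/
theorem cechSign_swap {J : Finset (Fin n)} {i j : Fin n} (hi : i ∈ J) (hj : j ∈ J) (h : i ≠ j) :
    cechSign k J i * cechSign k (J.erase i) j = - (cechSign k J j * cechSign k (J.erase j) i) := by
  rcases lt_or_gt_of_ne h with h | h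
  · rw [cechSign_erase_of_lt hi h, cechSign_erase_of_le h.le]; ring
  · rw [cechSign_erase_of_lt hj h, cechSign_erase_of_le h.le]; ring

end Sign

/-! ### The Čech complex: D² = 0 and torsion of its cohomology -/

section Complex

variable {k : Type*} [Field k] {n : ℕ} {M N : Type*}
  [AddCommGroup M] [Module (MvPolynomial (Fin n) k) M]
  [AddCommGroup N] [Module (MvPolynomial (Fin n) k) N]
  {𝓜 : ℕ → AddSubgroup M} {𝓝 : ℕ → AddSubgroup N}

theorem cechDifferential_eq_sum (φ : CechModule (k := k) (n := n) M) (J : Finset (Fin n)) :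
    cechDifferential M φ J =
      ∑ j ∈ J, cechSign k J j • restriction M (J.erase_subset j) (φ (J.erase j)) :=
  cechDifferential_apply φ J

theorem restriction_congr {J J' K : Finset (Fin n)} (φ : CechModule (k := k) (n := n) M)
    (e : J = J') (h : J ⊆ K) :
    restriction M h (φ J) = restriction M (e ▸ h) (φ J') := by
  subst e; rfl

theorem cechDifferential_cechDifferential (φ : CechModule (k := k) (n := n) M) :
    cechDifferential M (cechDifferential M φ) = 0 := by
  ext J
  have hsub : ∀ p : Fin n × Fin n, (J.erase p.1).erase p.2 ⊆ J := fun p =>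
    ((J.erase p.1).erase_subset p.2).trans (J.erase_subset p.1)
  let F : Fin n × Fin n → LocalizationAt (k := k) M J := fun p =>
    (cechSign k J p.1 * cechSign k (J.erase p.1) p.2) •
      restriction M (hsub p) (φ ((J.erase p.1).erase p.2))
  have h1 : cechDifferential M (cechDifferential M φ) J = ∑ p ∈ J.offDiag, F p := by
    rw [cechDifferential_eq_sum]
    trans ∑ i ∈ J, ∑ j ∈ J.erase i, F (i, j)
    · refine Finset.sum_congr rfl fun i _ => ?_
      rw [cechDifferential_eq_sum, map_sum, Finset.smul_sum]
      refine Finset.sum_congr rfl fun j _ => ?_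
      rw [map_smul, smul_smul, restriction_restriction]
    · rw [Finset.sum_sigma']
      refine Finset.sum_bij' (fun x _ => (x.1, x.2)) (fun x _ => ⟨x.1, x.2⟩) ?_ ?_ ?_ ?_ ?_
      · rintro ⟨i, j⟩ h
        simp only [Finset.mem_sigma, Finset.mem_erase, Finset.mem_offDiag] at h ⊢
        exact ⟨h.1, h.2.2, h.2.1.symm⟩
      · rintro ⟨i, j⟩ h
        simp only [Finset.mem_sigma, Finset.mem_erase, Finset.mem_offDiag] at h ⊢
        exact ⟨h.1, h.2.2.symm, h.2.1⟩
      all_goals intros; rfl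
  rw [h1]
  refine Finset.sum_involution (fun p _ => p.swap) ?_ ?_ ?_ ?_
  · rintro ⟨i, j⟩ h
    rw [Finset.mem_offDiag] at h
    simp only [F, Prod.swap]
    rw [cechSign_swap h.1 h.2.1 h.2.2, neg_smul,
      restriction_congr φ (Finset.erase_right_comm (a := i) (b := j)), neg_add_cancel]
  · rintro ⟨i, j⟩ h _ h'
    rw [Finset.mem_offDiag] at h
    exact h.2.2 (congrArg Prod.fst h').symm
  · rintro ⟨i, j⟩ h
    rw [Finset.mem_offDiag] at h ⊢
    exact ⟨h.2.1, h.1, h.2.2.symm⟩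
  · rintro ⟨i, j⟩ _
    rfl

/-- The cohomology of the Čech complex is `x_j`-torsion. -/
theorem exists_pow_smul_eq_cechDifferential {φ : CechModule (k := k) (n := n) M}
    (hφ : cechDifferential M φ = 0) (j : Fin n) :
    ∃ r : ℕ, ∃ ψ, cechDifferential M ψ = (X j ^ r : MvPolynomial (Fin n) k) • φ := by
  classical
  have h1 : ∃ r : ℕ, ∀ K : Finset (Fin n), ∃ y : LocalizationAt (k := k) M (K.erase j),
      restriction M (K.erase_subset j) y = (X j ^ r : MvPolynomial (Fin n) k) • φ K := by
    choose r hr using fun K : Finset (Fin n) => exists_restriction_erase j (φ K)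
    exact ⟨Finset.univ.sup r, fun K => hr K _ (Finset.le_sup (Finset.mem_univ K))⟩
  obtain ⟨r, hr⟩ := h1
  choose y hy using hr
  have hins : ∀ {J : Finset (Fin n)}, j ∉ J → (insert j J).erase j = J := fun h =>
    Finset.erase_insert h
  -- Contracting homotopy: up to sign, ψ_J is x_j^r φ_{J ∪ j}, pulled back to M_{x_J} after r has
  -- cleared x_j from all denominators.
  let ψ : CechModule (k := k) (n := n) M := fun J =>
    if h : j ∉ J then cechSign k (insert j J) j •
      restriction M (hins h).le (y (insert j J)) else 0
  have hψ0 : ∀ J, j ∈ J → ψ J = 0 := fun J h => dif_neg (not_not.2 h)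
  have hψ : ∀ J, j ∉ J → ∀ (h : J ⊆ insert j J), restriction M h (ψ J) =
      cechSign k (insert j J) j • (X j ^ r : MvPolynomial (Fin n) k) • φ (insert j J) := by
    intro J h h'
    simp only [ψ, dif_pos h, map_smul, restriction_restriction]
    rw [← hy]
  have hmem : ∀ K, j ∈ K → cechDifferential M ψ K = (X j ^ r : MvPolynomial (Fin n) k) • φ K := by
    intro K hK
    rw [cechDifferential_eq_sum, Finset.sum_eq_single_of_mem j hK]
    · have e : insert j (K.erase j) = K := Finset.insert_erase hK
      have h2 : ∀ K' (e : K' = K) (h : K.erase j ⊆ K'), restriction M h (ψ (K.erase j)) =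
          cechSign k K' j • (X j ^ r : MvPolynomial (Fin n) k) • φ K' →
          restriction M (K.erase_subset j) (ψ (K.erase j)) =
          cechSign k K j • (X j ^ r : MvPolynomial (Fin n) k) • φ K := by
        rintro K' rfl h H
        exact H
      rw [h2 _ e _ (hψ _ (Finset.notMem_erase j K) (Finset.subset_insert _ _)), smul_smul,
        cechSign_mul_self, one_smul]
    · intro i hi hij
      rw [hψ0 _ (Finset.mem_erase.2 ⟨hij.symm, hK⟩), map_zero, smul_zero]
  -- For j ∉ K the cocycle condition at K ∪ j gives the identity only after restriction to K ∪ j; a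
  -- further power of x_j kills the difference.
  have hnot : ∀ K, j ∉ K → restriction M (Finset.subset_insert j K)
      (cechDifferential M ψ K - (X j ^ r : MvPolynomial (Fin n) k) • φ K) = 0 := by
    intro K hK
    have hD : cechDifferential M φ (insert j K) = 0 := by rw [hφ]; rfl
    rw [cechDifferential_eq_sum, Finset.sum_insert hK] at hD
    have e : (insert j K).erase j = K := hins hK
    rw [restriction_congr φ e] at hD
    have hjL : j ∈ insert j K := Finset.mem_insert_self _ _
    have key : restriction M (Finset.subset_insert j K) (cechDifferential M ψ K) =
        -(cechSign k (insert j K) j • (X j ^ r : MvPolynomial (Fin n) k) •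
          ∑ i ∈ K, cechSign k (insert j K) i •
            restriction M ((insert j K).erase_subset i) (φ ((insert j K).erase i))) := by
      rw [cechDifferential_eq_sum, map_sum, Finset.smul_sum, Finset.smul_sum,
        ← Finset.sum_neg_distrib]
      refine Finset.sum_congr rfl fun i hi => ?_
      have hij : i ≠ j := fun h => hK (h ▸ hi)
      have hiL : i ∈ insert j K := Finset.mem_insert_of_mem hi
      have hjK' : j ∉ K.erase i := fun h => hK (Finset.mem_of_mem_erase h)
      have e2 : insert j (K.erase i) = (insert j K).erase i :=
        (Finset.erase_insert_of_ne hij.symm).symm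
      have h3 : restriction M (((K.erase_subset i).trans (Finset.subset_insert j K)))
          (ψ (K.erase i)) = cechSign k ((insert j K).erase i) j •
            (X j ^ r : MvPolynomial (Fin n) k) •
            restriction M ((insert j K).erase_subset i) (φ ((insert j K).erase i)) := by
        rw [← restriction_restriction (Finset.subset_insert j (K.erase i))
          (Finset.insert_subset_insert j (K.erase_subset i)), hψ _ hjK', map_smul, map_smul,
          restriction_congr φ e2, congrArg (cechSign k · j) e2]
      rw [map_smul, restriction_restriction, h3]
      simp only [smul_smul, ← neg_smul]
      congr 1
      have h4 := cechSign_swap (k := k) hiL hjL hij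
      rw [e] at h4
      have h6 := cechSign_mul_self (k := k) (insert j K) i
      have h7 := cechSign_mul_self (k := k) K i
      linear_combination X j ^ r * cechSign k K i * cechSign k (insert j K) i * h4 -
        X j ^ r * cechSign k K i * cechSign k ((insert j K).erase i) j * h6 -
        X j ^ r * cechSign k (insert j K) i * cechSign k (insert j K) j * h7
    rw [map_sub, key, ← neg_eq_of_add_eq_zero_right hD, smul_neg, smul_neg, neg_neg,
      smul_comm (X j ^ r : MvPolynomial (Fin n) k), smul_smul (cechSign k (insert j K) j),
      cechSign_mul_self, one_smul, map_smul, sub_self]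
  have h2 : ∃ s : ℕ, ∀ K : Finset (Fin n), (X j ^ s : MvPolynomial (Fin n) k) •
      (cechDifferential M ψ K - (X j ^ r : MvPolynomial (Fin n) k) • φ K) = 0 := by
    have : ∀ K : Finset (Fin n), ∃ s₀ : ℕ, ∀ s, s₀ ≤ s → (X j ^ s : MvPolynomial (Fin n) k) •
        (cechDifferential M ψ K - (X j ^ r : MvPolynomial (Fin n) k) • φ K) = 0 := by
      intro K
      by_cases hK : j ∈ K
      · exact ⟨0, fun s _ => by rw [hmem K hK, sub_self, smul_zero]⟩
      · exact exists_pow_smul_eq_zero_of_restriction (hnot K hK)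
    choose s hs using this
    exact ⟨Finset.univ.sup s, fun K => hs K _ (Finset.le_sup (Finset.mem_univ K))⟩
  obtain ⟨s, hs⟩ := h2
  refine ⟨s + r, (X j ^ s : MvPolynomial (Fin n) k) • ψ, ?_⟩
  ext K
  have := hs K
  rw [smul_sub, sub_eq_zero, smul_smul, ← pow_add] at this
  rw [map_smul]
  exact this

end Complex

/-! ### Long exact sequences, degree by degree -/

section CechMap

variable {k : Type*} [Field k] {n : ℕ} {A B C : Type*}
  [AddCommGroup A] [Module (MvPolynomial (Fin n) k) A]
  [AddCommGroup B] [Module (MvPolynomial (Fin n) k) B]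
  [AddCommGroup C] [Module (MvPolynomial (Fin n) k) C]
  {𝓐 : ℕ → AddSubgroup A} {𝓑 : ℕ → AddSubgroup B} {𝓒 : ℕ → AddSubgroup C}

variable (k n) in
/-- The degrees in which the `p`-th local cohomology of a graded module does not vanish. -/
def nonvanishingDegrees (𝓐 : ℕ → AddSubgroup A) (p : ℕ) : Set ℤ :=
  {d | localCohomologyPart (k := k) (n := n) 𝓐 p d ≠ ⊥}

/-- The primitives ψ range over all cochains, not just homogeneous ones, because the total
cohomology is a quotient by all boundaries. -/
theorem GradingProjections.mem_nonvanishingDegrees_iff (P : GradingProjections k n 𝓐) {p : ℕ}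
    {d : ℤ} : d ∈ nonvanishingDegrees k n 𝓐 p ↔
      ∃ φ, P.cechProj p d φ = φ ∧ cechDifferential A φ = 0 ∧ ∀ ψ, cechDifferential A ψ ≠ φ := by
  rw [nonvanishingDegrees, Set.mem_ofPred_eq, AddSubgroup.ne_bot_iff_exists_ne_zero]
  constructor
  · rintro ⟨⟨_, ⟨φ, hφ, rfl⟩⟩, hne⟩
    refine ⟨φ, (P.mem_cechCochains_iff p d _).1 hφ, φ.2, fun ψ hψ => hne ?_⟩
    refine Subtype.ext ((Submodule.Quotient.mk_eq_zero _).2 ?_)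
    exact ⟨ψ, hψ⟩
  · rintro ⟨φ, hφ, hD, hne⟩
    refine ⟨⟨_, ⟨⟨φ, hD⟩, (P.mem_cechCochains_iff p d _).2 hφ, rfl⟩⟩, fun h => ?_⟩
    obtain ⟨ψ, hψ⟩ := (Submodule.Quotient.mk_eq_zero _).1 (congrArg Subtype.val h)
    exact hne ψ hψ

/-- The map of Čech complexes induced by a linear map. -/
def cechMap (f : A →ₗ[MvPolynomial (Fin n) k] B) :
    CechModule (k := k) (n := n) A →ₗ[MvPolynomial (Fin n) k] CechModule (k := k) (n := n) B :=
  LinearMap.pi fun J => localizationMap f J ∘ₗ LinearMap.proj J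

theorem cechMap_apply (f : A →ₗ[MvPolynomial (Fin n) k] B)
    (φ : CechModule (k := k) (n := n) A) (J : Finset (Fin n)) :
    cechMap f φ J = localizationMap f J (φ J) := rfl

theorem cechDifferential_cechMap (f : A →ₗ[MvPolynomial (Fin n) k] B)
    (φ : CechModule (k := k) (n := n) A) :
    cechDifferential B (cechMap f φ) = cechMap f (cechDifferential A φ) := by
  ext J
  simp only [cechMap_apply, cechDifferential_eq_sum, map_sum, map_smul,
    localizationMap_restriction]

theorem cechMap_surjective {g : B →ₗ[MvPolynomial (Fin n) k] C} (hg : Function.Surjective g) :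
    Function.Surjective (cechMap g) := fun φ => by
  choose ψ hψ using fun J => localizationMap_surjective hg J (φ J)
  exact ⟨ψ, funext hψ⟩

theorem cechMap_exact {f : A →ₗ[MvPolynomial (Fin n) k] B} {g : B →ₗ[MvPolynomial (Fin n) k] C}
    (h : Function.Exact f g) : Function.Exact (cechMap f) (cechMap g) := by
  intro φ
  constructor
  · intro hφ
    choose ψ hψ using fun J => (localizationMap_exact h J (φ J)).1 (congrFun hφ J)
    exact ⟨ψ, funext hψ⟩
  · rintro ⟨ψ, rfl⟩
    ext J
    rw [cechMap_apply, cechMap_apply]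
    exact (localizationMap_exact h J _).2 ⟨ψ J, rfl⟩

namespace GradingProjections

variable {P : GradingProjections k n 𝓐} {Q : GradingProjections k n 𝓑}
  {R : GradingProjections k n 𝓒}

theorem cechProj_cechMap {f : A →ₗ[MvPolynomial (Fin n) k] B} {c : ℤ}
    (hf : P.IsHomogeneousMap Q f c) (p d : ℤ) (φ : CechModule (k := k) (n := n) A) :
    Q.cechProj p (d + c) (cechMap f φ) = cechMap f (P.cechProj p d φ) := by
  ext J
  simp only [cechProj_apply, cechMap_apply]
  split_ifs
  · exact locProj_localizationMap hf J d _
  · rw [map_zero]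

theorem apply_eq_zero {p d : ℤ} {φ : CechModule (k := k) (n := n) A}
    (hφ : P.cechProj p d φ = φ) {J : Finset (Fin n)} (hJ : (J.card : ℤ) ≠ p) : φ J = 0 := by
  rw [← hφ, cechProj_apply, if_neg hJ]

theorem apply_eq_zero_of_cechMap {f : A →ₗ[MvPolynomial (Fin n) k] B}
    (hf : ∀ m, f m = 0 → ∀ j, ∃ r : ℕ, (X j ^ r : MvPolynomial (Fin n) k) • m = 0)
    {φ : CechModule (k := k) (n := n) A} (h : cechMap f φ = 0) {J : Finset (Fin n)}
    (hJ : J.Nonempty) : φ J = 0 :=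
  localizationMap_injective hf hJ (congrFun h J)

/-- A torsion kernel survives only in the summand J = ∅, which is absent when p ≠ 0. -/
theorem eq_zero_of_cechMap {f : A →ₗ[MvPolynomial (Fin n) k] B}
    (hf : ∀ m, f m = 0 → ∀ j, ∃ r : ℕ, (X j ^ r : MvPolynomial (Fin n) k) • m = 0)
    {p d : ℤ} (hp : p ≠ 0) {φ : CechModule (k := k) (n := n) A}
    (hφ : P.cechProj p d φ = φ) (h : cechMap f φ = 0) : φ = 0 := by
  ext J
  rcases J.eq_empty_or_nonempty with rfl | hJ
  · exact apply_eq_zero hφ (by simpa using hp.symm)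
  · exact apply_eq_zero_of_cechMap hf h hJ

variable (P Q R) in
/-- A right exact sequence of graded modules `A → B → C` whose first map has degree `c` and whose
second map has degree `0`; it is exact on the left up to torsion with respect to the variables. -/
structure IsAlmostShortExact (f : A →ₗ[MvPolynomial (Fin n) k] B)
    (g : B →ₗ[MvPolynomial (Fin n) k] C) (c : ℤ) : Prop where
  left : P.IsHomogeneousMap Q f c
  right : ∀ e m, R.proj e (g m) = g (Q.proj e m)
  exact : Function.Exact f g
  surjective : Function.Surjective g
  torsion : ∀ m, f m = 0 → ∀ j, ∃ r : ℕ, (X j ^ r : MvPolynomial (Fin n) k) • m = 0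

namespace IsAlmostShortExact

variable {f : A →ₗ[MvPolynomial (Fin n) k] B} {g : B →ₗ[MvPolynomial (Fin n) k] C} {c : ℤ}
  (h : IsAlmostShortExact P Q R f g c)

include h

theorem cechProj_right (p d : ℤ) (φ : CechModule (k := k) (n := n) B) :
    R.cechProj p d (cechMap g φ) = cechMap g (Q.cechProj p d φ) := by
  simpa using cechProj_cechMap (P := Q) (Q := R) (f := g) (c := 0)
    (fun e m => by rw [add_zero]; exact h.right e m) p d φ

theorem exists_lift_left {p d : ℤ} {φ : CechModule (k := k) (n := n) B}
    (hφ : Q.cechProj p d φ = φ) (hg : cechMap g φ = 0) :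
    ∃ ω, P.cechProj p (d - c) ω = ω ∧ cechMap f ω = φ := by
  obtain ⟨ω, rfl⟩ := (cechMap_exact h.exact φ).1 hg
  refine ⟨P.cechProj p (d - c) ω, cechProj_cechProj .., ?_⟩
  rw [← cechProj_cechMap h.left, sub_add_cancel, hφ]

theorem exists_lift_right {p d : ℤ} {φ : CechModule (k := k) (n := n) C}
    (hφ : R.cechProj p d φ = φ) : ∃ ψ, Q.cechProj p d ψ = ψ ∧ cechMap g ψ = φ := by
  obtain ⟨ψ, rfl⟩ := cechMap_surjective h.surjective φ
  exact ⟨Q.cechProj p d ψ, cechProj_cechProj .., by rw [← h.cechProj_right, hφ]⟩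

theorem cechMap_comp (ω : CechModule (k := k) (n := n) A) : cechMap g (cechMap f ω) = 0 :=
  (cechMap_exact h.exact _).2 ⟨ω, rfl⟩

/-- If `f` maps a cochain of degree `d - c` to a cocycle then, in positive cohomological degree, it
is a cocycle. -/
theorem cechDifferential_eq_zero {p : ℕ} {d : ℤ} {ω : CechModule (k := k) (n := n) A}
    (hω : P.cechProj p d ω = ω) (hD : cechDifferential B (cechMap f ω) = 0) :
    cechDifferential A ω = 0 := by
  refine eq_zero_of_cechMap (P := P) h.torsion (p := p + 1) (d := d) (by omega) ?_ ?_
  · rw [← P.cechDifferential_cechProj, hω]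
  · rw [← cechDifferential_cechMap, hD]

/-- Exactness of H^p(B)_d → H^p(C)_d → H^{p+1}(A)_{d-c}. The connecting cocycle lives in positive
cohomological degree, where f is injective on cochains. -/
theorem mem_or_mem_of_mem_right {p : ℕ} {d : ℤ} (hd : d ∈ nonvanishingDegrees k n 𝓒 p) :
    d ∈ nonvanishingDegrees k n 𝓑 p ∨ d - c ∈ nonvanishingDegrees k n 𝓐 (p + 1) := by
  obtain ⟨φ', hφ', hD', hne'⟩ := R.mem_nonvanishingDegrees_iff.1 hd
  obtain ⟨φ, hφ, rfl⟩ := h.exists_lift_right hφ'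
  obtain ⟨ω, hω, hωφ⟩ := h.exists_lift_left (p := (p + 1 : ℕ)) (d := d)
    (φ := cechDifferential B φ) (by
      rw [Nat.cast_add, Nat.cast_one, ← Q.cechDifferential_cechProj, hφ])
    (by rw [← cechDifferential_cechMap, hD'])
  have hDω : cechDifferential A ω = 0 := h.cechDifferential_eq_zero hω (by
    rw [hωφ, cechDifferential_cechDifferential])
  by_cases hb : ∃ ψ, cechDifferential A ψ = ω
  · left
    obtain ⟨ψ, hψ⟩ := hb
    have hψ2 : cechDifferential A (P.cechProj p (d - c) ψ) = ω := by
      rw [P.cechDifferential_cechProj, hψ]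
      exact_mod_cast hω
    -- The connecting class vanishes, so subtracting the image of its primitive corrects the lift to
    -- a cocycle over the same class.
    refine Q.mem_nonvanishingDegrees_iff.2 ⟨φ - cechMap f (P.cechProj p (d - c) ψ), ?_, ?_, ?_⟩
    · rw [map_sub, hφ]
      congr 1
      have := cechProj_cechMap h.left p (d - c) (P.cechProj p (d - c) ψ)
      rwa [sub_add_cancel, cechProj_cechProj] at this
    · rw [map_sub, cechDifferential_cechMap, hψ2, hωφ, sub_self]
    · intro χ hχ
      apply hne' (cechMap g χ)
      rw [cechDifferential_cechMap, hχ, map_sub, h.cechMap_comp, sub_zero]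
  · right
    push Not at hb
    exact P.mem_nonvanishingDegrees_iff.2 ⟨ω, hω, hDω, hb⟩

/-- Exactness of H^p(A)_{d-c} → H^p(B)_d → H^p(C)_d. It holds also for p = 0: that the lift to A is
a cocycle is checked in degree p + 1. -/
theorem mem_or_mem_of_mem_middle {p : ℕ} {d : ℤ} (hd : d ∈ nonvanishingDegrees k n 𝓑 p) :
    d - c ∈ nonvanishingDegrees k n 𝓐 p ∨ d ∈ nonvanishingDegrees k n 𝓒 p := by
  obtain ⟨φ, hφ, hD, hne⟩ := Q.mem_nonvanishingDegrees_iff.1 hd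
  by_cases hb : ∃ ψ, cechDifferential C ψ = cechMap g φ
  swap
  · right
    push Not at hb
    refine R.mem_nonvanishingDegrees_iff.2 ⟨cechMap g φ, ?_, ?_, hb⟩
    · rw [h.cechProj_right, hφ]
    · rw [cechDifferential_cechMap, hD, map_zero]
  left
  obtain ⟨ψ', hψ'⟩ := hb
  obtain ⟨ψ, rfl⟩ := cechMap_surjective h.surjective ψ'
  -- For p = 0 the projection to C^{-1} is zero, so this case needs no separate treatment.
  have hψ2 : Q.cechProj p d (cechDifferential B (Q.cechProj (p - 1) d ψ)) =
      cechDifferential B (Q.cechProj (p - 1) d ψ) := by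
    rw [Q.cechDifferential_cechProj, sub_add_cancel, cechProj_cechProj]
  obtain ⟨ω, hω, hωφ⟩ := h.exists_lift_left (p := p) (d := d)
    (φ := φ - cechDifferential B (Q.cechProj (p - 1) d ψ)) (by rw [map_sub, hφ, hψ2]) (by
      rw [Q.cechDifferential_cechProj, sub_add_cancel, map_sub, ← h.cechProj_right,
        ← cechDifferential_cechMap, hψ', h.cechProj_right, hφ, sub_self])
  refine P.mem_nonvanishingDegrees_iff.2 ⟨ω, hω, h.cechDifferential_eq_zero hω ?_, ?_⟩
  · rw [hωφ, map_sub, hD, cechDifferential_cechDifferential, sub_self]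
  · rintro χ rfl
    refine hne (cechMap f χ + Q.cechProj (p - 1) d ψ) ?_
    rw [map_add, cechDifferential_cechMap, hωφ, sub_add_cancel]

/-- A class of `H^{p+1}(A)` that dies in `H^{p+1}(B)` comes from `H^p(C)`. -/
theorem mem_right_of_boundary {p : ℕ} {d : ℤ} {φ : CechModule (k := k) (n := n) A}
    (hφ : P.cechProj (p + 1 : ℕ) d φ = φ) (hne : ∀ ψ, cechDifferential A ψ ≠ φ)
    (hb : ∃ ψ, cechDifferential B ψ = cechMap f φ) :
    d + c ∈ nonvanishingDegrees k n 𝓒 p := by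
  obtain ⟨ψ', hψ'⟩ := hb
  obtain ⟨ψ, hψp, hψ⟩ : ∃ ψ, Q.cechProj p (d + c) ψ = ψ ∧ cechDifferential B ψ = cechMap f φ := by
    refine ⟨Q.cechProj p (d + c) ψ', cechProj_cechProj .., ?_⟩
    rw [Q.cechDifferential_cechProj, hψ', cechProj_cechMap h.left]
    exact congrArg _ (by exact_mod_cast hφ)
  refine R.mem_nonvanishingDegrees_iff.2 ⟨cechMap g ψ, ?_, ?_, ?_⟩
  · rw [h.cechProj_right, hψp]
  · rw [cechDifferential_cechMap, hψ, h.cechMap_comp]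
  · intro χ' hχ
    obtain ⟨χ, rfl⟩ := cechMap_surjective h.surjective χ'
    obtain ⟨ω, hω⟩ := (cechMap_exact h.exact (ψ - cechDifferential B χ)).1 (by
      rw [map_sub, ← cechDifferential_cechMap, hχ, sub_self])
    have h0 : cechMap f (φ - cechDifferential A ω) = 0 := by
      rw [map_sub, ← cechDifferential_cechMap, hω, map_sub, cechDifferential_cechDifferential,
        sub_zero, hψ, sub_self]
    have h1 : cechMap f (P.cechProj (p + 1 : ℕ) d (φ - cechDifferential A ω)) = 0 := by
      rw [← cechProj_cechMap h.left, h0, map_zero]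
    have h2 := eq_zero_of_cechMap (P := P) h.torsion (by omega) (cechProj_cechProj ..) h1
    rw [map_sub, hφ, sub_eq_zero, Nat.cast_add, Nat.cast_one,
      ← P.cechDifferential_cechProj] at h2
    exact hne _ h2.symm

theorem mem_or_mem_of_mem_left {p : ℕ} {d : ℤ}
    (hd : d ∈ nonvanishingDegrees k n 𝓐 (p + 1)) :
    d + c ∈ nonvanishingDegrees k n 𝓑 (p + 1) ∨ d + c ∈ nonvanishingDegrees k n 𝓒 p := by
  obtain ⟨φ, hφ, hD, hne⟩ := P.mem_nonvanishingDegrees_iff.1 hd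
  by_cases hb : ∃ ψ, cechDifferential B ψ = cechMap f φ
  · exact Or.inr (h.mem_right_of_boundary hφ hne hb)
  · push Not at hb
    refine Or.inl (Q.mem_nonvanishingDegrees_iff.2 ⟨cechMap f φ, ?_, ?_, hb⟩)
    · rw [cechProj_cechMap h.left, hφ]
    · rw [cechDifferential_cechMap, hD, map_zero]

end IsAlmostShortExact

theorem cechMap_lsmul (s : MvPolynomial (Fin n) k) (φ : CechModule (k := k) (n := n) A) :
    cechMap (LinearMap.lsmul _ A s) φ = s • φ := by
  ext J
  rw [cechMap_apply, Pi.smul_apply]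
  induction φ J using LocalizedModule.induction_on with
  | h m t => rw [localizationMap_mk, LocalizedModule.smul'_mk]; rfl

/-- Cohomology is x_j-torsion. The last nonzero multiple of the class by a power of x_j, in degree
d' ≥ d, is killed by x_j and so is the image of a class of H^p(C)_{d'+1}. -/
theorem IsAlmostShortExact.exists_mem_right {j : Fin n} {g : A →ₗ[MvPolynomial (Fin n) k] C}
    (h : IsAlmostShortExact P P R (LinearMap.lsmul _ A (X j : MvPolynomial (Fin n) k)) g 1)
    {p : ℕ} {d : ℤ} (hd : d ∈ nonvanishingDegrees k n 𝓐 (p + 1)) :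
    ∃ d', d ≤ d' ∧ d' + 1 ∈ nonvanishingDegrees k n 𝓒 p := by
  obtain ⟨φ, hφ, hD, hne⟩ := P.mem_nonvanishingDegrees_iff.1 hd
  obtain ⟨r, ψ, hψ⟩ := exists_pow_smul_eq_cechDifferential hD j
  clear hd
  induction r generalizing φ d with
  | zero =>
    rw [pow_zero, one_smul] at hψ
    exact absurd hψ (hne ψ)
  | succ r ih =>
    by_cases hb : ∃ ψ, cechDifferential A ψ = (X j : MvPolynomial (Fin n) k) • φ
    · refine ⟨d, le_rfl, h.mem_right_of_boundary hφ hne ?_⟩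
      rwa [cechMap_lsmul]
    · push Not at hb
      obtain ⟨d', hd', hm⟩ := ih (d := d + 1) ((X j : MvPolynomial (Fin n) k) • φ)
        (by rw [← cechMap_lsmul, cechProj_cechMap h.left, hφ]) (by rw [map_smul, hD, smul_zero])
        hb (by rw [hψ, pow_succ, mul_smul])
      exact ⟨d', by omega, hm⟩

end GradingProjections

end CechMap

/-! ### Zeroth local cohomology as torsion -/

section DegreeZero

variable {k : Type*} [Field k] {n : ℕ} {A B : Type*}
  [AddCommGroup A] [Module (MvPolynomial (Fin n) k) A]
  [AddCommGroup B] [Module (MvPolynomial (Fin n) k) B]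
  {𝓐 : ℕ → AddSubgroup A} {𝓑 : ℕ → AddSubgroup B}
  (P : GradingProjections k n 𝓐) (Q : GradingProjections k n 𝓑)

theorem eq_one_of_mem_variableMonoid_empty {s : MvPolynomial (Fin n) k}
    (hs : s ∈ variableMonoid k (∅ : Finset (Fin n))) : s = 1 := by
  simpa [variableMonoid] using hs

theorem localization_mk_empty_eq_zero {m : A} {s : variableMonoid k (∅ : Finset (Fin n))} :
    (LocalizedModule.mk m s : LocalizationAt (k := k) A ∅) = 0 ↔ m = 0 := by
  rw [localization_mk_eq_zero]
  constructor
  · rintro ⟨⟨u, hu⟩, h⟩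
    obtain rfl := eq_one_of_mem_variableMonoid_empty hu
    simpa [Submonoid.smul_def] using h
  · rintro rfl
    exact ⟨1, smul_zero _⟩

theorem localization_mk_empty_inj {m m' : A} :
    (LocalizedModule.mk m 1 : LocalizationAt (k := k) (n := n) A ∅) =
      LocalizedModule.mk m' 1 ↔ m = m' := by
  rw [LocalizedModule.mk_eq]
  constructor
  · rintro ⟨⟨u, hu⟩, h⟩
    obtain rfl := eq_one_of_mem_variableMonoid_empty hu
    simpa [Submonoid.smul_def] using h
  · rintro rfl
    exact ⟨1, rfl⟩

/-- The Čech cochain of degree zero given by an element of the module. -/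
def cechZeroCochain (m : A) : CechModule (k := k) (n := n) A :=
  Pi.single ∅ (LocalizedModule.mk m 1)

theorem cechDifferential_apply_empty (ψ : CechModule (k := k) (n := n) A) :
    cechDifferential A ψ ∅ = 0 := by
  rw [cechDifferential_eq_sum, Finset.sum_empty]

theorem exists_pow_smul_eq_zero_iff {m : A} {j : Fin n} :
    (LocalizedModule.mk m 1 : LocalizationAt (k := k) A {j}) = 0 ↔
      ∃ r : ℕ, (X j ^ r : MvPolynomial (Fin n) k) • m = 0 := by
  rw [localization_mk_eq_zero]
  constructor
  · rintro ⟨⟨u, hu⟩, h⟩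
    have : ∃ r : ℕ, X j ^ r = u := by
      have h2 : variableMonoid k ({j} : Finset (Fin n)) =
          Submonoid.closure {(X j : MvPolynomial (Fin n) k)} := by
        simp [variableMonoid]
      rw [h2] at hu
      exact Submonoid.mem_closure_singleton.1 hu
    obtain ⟨r, rfl⟩ := this
    exact ⟨r, h⟩
  · rintro ⟨r, h⟩
    exact ⟨⟨X j, X_mem_variableMonoid (Finset.mem_singleton_self j)⟩ ^ r, h⟩

namespace GradingProjections

/-- There are no boundaries in C^0, and a 0-cochain is a cocycle exactly when its element vanishes
in each M_{x_j}. -/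
theorem mem_nonvanishingDegrees_zero_iff {d : ℤ} :
    d ∈ nonvanishingDegrees k n 𝓐 0 ↔ ∃ m, m ≠ 0 ∧ P.proj d m = m ∧
      ∀ j : Fin n, ∃ r : ℕ, (X j ^ r : MvPolynomial (Fin n) k) • m = 0 := by
  rw [P.mem_nonvanishingDegrees_iff]
  constructor
  · rintro ⟨φ, hφ, hD, hne⟩
    obtain ⟨m, hm⟩ : ∃ m, φ ∅ = LocalizedModule.mk m 1 := by
      induction φ ∅ using LocalizedModule.induction_on with
      | h m s => exact ⟨m, congrArg _ (Subtype.ext (eq_one_of_mem_variableMonoid_empty s.2))⟩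
    refine ⟨m, ?_, ?_, fun j => ?_⟩
    · rintro rfl
      rw [LocalizedModule.zero_mk] at hm
      refine hne 0 ?_
      rw [map_zero]
      ext J
      by_cases hJ : J = ∅
      · subst hJ; exact hm.symm
      · exact (apply_eq_zero hφ (by simpa using hJ)).symm
    · have := congrFun hφ ∅
      rw [cechProj_apply, if_pos (by simp), hm, locProj_mk] at this
      rw [localization_mk_empty_inj] at this
      simpa using this
    · have := congrFun hD {j}
      rw [cechDifferential_eq_sum, Finset.sum_singleton,
        restriction_congr φ (J' := ∅) (by simp), hm, restriction_mk] at this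
      have hs : cechSign k ({j} : Finset (Fin n)) j = 1 := by
        simp [cechSign, Finset.filter_singleton]
      rw [hs, one_smul] at this
      exact exists_pow_smul_eq_zero_iff.1 this
  · rintro ⟨m, hm, hd, ht⟩
    refine ⟨cechZeroCochain m, ?_, ?_, ?_⟩
    · ext J
      rw [cechProj_apply]
      by_cases hJ : J = ∅
      · subst hJ
        rw [if_pos (by simp), cechZeroCochain, Pi.single_eq_same, locProj_mk]
        simp [hd]
      · rw [if_neg (by simpa using hJ), cechZeroCochain, Pi.single_eq_of_ne hJ]
    · ext J
      rw [cechDifferential_eq_sum]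
      refine Finset.sum_eq_zero fun j hj => ?_
      by_cases hJ : J = {j}
      · subst hJ
        rw [restriction_congr _ (J' := ∅) (by simp), cechZeroCochain, Pi.single_eq_same,
          restriction_mk]
        exact (congrArg _ (exists_pow_smul_eq_zero_iff.2 (ht j))).trans (smul_zero _)
      · have : J.erase j ≠ ∅ := fun h => by
          rcases (Finset.erase_eq_empty_iff _ _).1 h with rfl | h
          · simp at hj
          · exact hJ h
        rw [cechZeroCochain, Pi.single_eq_of_ne this, map_zero, smul_zero]
    · intro ψ hψ
      have := congrFun hψ ∅
      rw [cechDifferential_apply_empty, cechZeroCochain, Pi.single_eq_same, eq_comm,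
        localization_mk_empty_eq_zero] at this
      exact hm this

/-- The nonvanishing degrees of `H^0` are bounded by degrees of elements killed by `x_j`. -/
theorem exists_X_smul_eq_zero (j : Fin n) {d : ℤ} (hd : d ∈ nonvanishingDegrees k n 𝓐 0) :
    ∃ d', d ≤ d' ∧ ∃ m, m ≠ 0 ∧ P.proj d' m = m ∧ (X j : MvPolynomial (Fin n) k) • m = 0 := by
  obtain ⟨m, hm, hmd, ht⟩ := P.mem_nonvanishingDegrees_zero_iff.1 hd
  obtain ⟨r, hr⟩ := ht j
  clear ht hd
  induction r generalizing d m with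
  | zero => exact absurd (by simpa using hr) hm
  | succ r ih =>
    by_cases h0 : (X j : MvPolynomial (Fin n) k) • m = 0
    · exact ⟨d, le_rfl, m, hm, hmd, h0⟩
    · obtain ⟨d', hd', H⟩ := ih (d := d + 1) _ h0 (by rw [P.proj_X_smul, hmd])
        (by rw [smul_smul, ← pow_succ, hr])
      exact ⟨d', by omega, H⟩

/-- An injective graded map is injective on the zeroth local cohomology. -/
theorem nonvanishingDegrees_zero_subset {f : A →ₗ[MvPolynomial (Fin n) k] B}
    (hf : Function.Injective f) (hdeg : ∀ e m, Q.proj e (f m) = f (P.proj e m)) :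
    nonvanishingDegrees k n 𝓐 0 ⊆ nonvanishingDegrees k n 𝓑 0 := by
  intro d hd
  obtain ⟨m, hm, hmd, ht⟩ := P.mem_nonvanishingDegrees_zero_iff.1 hd
  refine Q.mem_nonvanishingDegrees_zero_iff.2 ⟨f m, ?_, ?_, fun j => ?_⟩
  · rwa [ne_eq, map_eq_zero_iff f hf]
  · rw [hdeg, hmd]
  · obtain ⟨r, hr⟩ := ht j
    exact ⟨r, by rw [← map_smul, hr, map_zero]⟩

end GradingProjections

end DegreeZero

/-! ### Ideals and quotients of S, and the two exact sequences -/

section Gradings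

variable {k : Type*} [Field k] {n : ℕ}

/-- The homogeneous component of degree `e : ℤ` of a polynomial. -/
def polyProj (e : ℤ) : MvPolynomial (Fin n) k →+ MvPolynomial (Fin n) k :=
  if 0 ≤ e then (homogeneousComponent e.toNat).toAddMonoidHom else 0

theorem polyProj_natCast (e : ℕ) (f : MvPolynomial (Fin n) k) :
    polyProj (e : ℤ) f = homogeneousComponent e f := by
  simp [polyProj]

theorem polyProj_of_neg {e : ℤ} (he : e < 0) (f : MvPolynomial (Fin n) k) :
    polyProj e f = 0 := by
  simp [polyProj, not_le.2 he]

theorem coeff_polyProj (e : ℤ) (f : MvPolynomial (Fin n) k) (a : Fin n →₀ ℕ) :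
    coeff a (polyProj e f) = if (a.degree : ℤ) = e then coeff a f else 0 := by
  rcases lt_or_ge e 0 with h | h
  · rw [polyProj_of_neg h, if_neg (by omega), coeff_zero]
  · lift e to ℕ using h
    rw [polyProj_natCast, coeff_homogeneousComponent]
    simp

theorem polyProj_polyProj (e : ℤ) (f : MvPolynomial (Fin n) k) :
    polyProj e (polyProj e f) = polyProj e f := by
  ext a
  simp only [coeff_polyProj]
  split_ifs <;> rfl

theorem polyProj_X_mul (e : ℤ) (i : Fin n) (f : MvPolynomial (Fin n) k) :
    polyProj (e + 1) (X i * f) = X i * polyProj e f := by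
  ext a
  simp only [coeff_polyProj, coeff_X_mul']
  by_cases hi : i ∈ a.support
  · have : a.degree = (a - Finsupp.single i 1).degree + 1 := by
      conv_lhs => rw [← tsub_add_cancel_of_le
        (Finsupp.single_le_iff.2 (Nat.one_le_iff_ne_zero.2 (Finsupp.mem_support_iff.1 hi))),
        map_add, Finsupp.degree_single]
    simp [hi, this]
  · simp [hi]

theorem isHomogeneous_iff_polyProj (e : ℕ) (f : MvPolynomial (Fin n) k) :
    f ∈ homogeneousSubmodule (Fin n) k e ↔ polyProj (e : ℤ) f = f := by
  rw [polyProj_natCast, mem_homogeneousSubmodule]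
  exact ⟨homogeneousComponent_eq_self, fun h => h ▸ homogeneousComponent_isHomogeneous e f⟩

theorem polyProj_mem {I : Ideal (MvPolynomial (Fin n) k)}
    (hI : I.IsHomogeneous (homogeneousSubmodule (Fin n) k)) (e : ℤ) {f : MvPolynomial (Fin n) k}
    (hf : f ∈ I) : polyProj e f ∈ I := by
  rcases lt_or_ge e 0 with h | h
  · rw [polyProj_of_neg h]; exact zero_mem _
  · lift e to ℕ using h
    rw [polyProj_natCast]
    exact homogeneousComponent_mem_of_mem hI hf e

variable {I J : Ideal (MvPolynomial (Fin n) k)}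

/-- The grading projections of `S / I`. -/
def quotientProjections (hI : I.IsHomogeneous (homogeneousSubmodule (Fin n) k)) :
    GradingProjections k n (quotientGrading I) where
  proj e := QuotientAddGroup.map I.toAddSubgroup I.toAddSubgroup (polyProj e)
    fun _ hf => polyProj_mem hI e hf
  mem_iff e m := by
    constructor
    · rintro ⟨f, hf, rfl⟩
      exact congrArg (Ideal.Quotient.mk I) ((isHomogeneous_iff_polyProj e f).1 hf)
    · intro h
      obtain ⟨f, rfl⟩ := Ideal.Quotient.mk_surjective m
      exact ⟨polyProj e f, (isHomogeneous_iff_polyProj e _).2 (polyProj_polyProj _ _), h⟩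
  proj_proj e m := by
    obtain ⟨f, rfl⟩ := Ideal.Quotient.mk_surjective m
    exact congrArg (Ideal.Quotient.mk I) (polyProj_polyProj e f)
  proj_neg e he m := by
    obtain ⟨f, rfl⟩ := Ideal.Quotient.mk_surjective m
    exact congrArg (Ideal.Quotient.mk I) (polyProj_of_neg he f)
  proj_X_smul e i m := by
    obtain ⟨f, rfl⟩ := Ideal.Quotient.mk_surjective m
    exact congrArg (Ideal.Quotient.mk I) (polyProj_X_mul e i f)

@[simp]
theorem quotientProjections_proj_mk (hI : I.IsHomogeneous (homogeneousSubmodule (Fin n) k))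
    (e : ℤ) (f : MvPolynomial (Fin n) k) : (quotientProjections hI).proj e
      (Ideal.Quotient.mk I f) = Ideal.Quotient.mk I (polyProj e f) := rfl

/-- The grading projections of `I`. -/
def idealProjections (hI : I.IsHomogeneous (homogeneousSubmodule (Fin n) k)) :
    GradingProjections k n (idealGrading I) where
  proj e := AddMonoidHom.mk' (fun f => ⟨polyProj e f, polyProj_mem hI e f.2⟩)
    fun f g => Subtype.ext (map_add (polyProj e) (f : MvPolynomial (Fin n) k) g)
  mem_iff e _ := (isHomogeneous_iff_polyProj e _).trans
    ⟨fun h => Subtype.ext h, fun h => congrArg Subtype.val h⟩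
  proj_proj e _ := Subtype.ext (polyProj_polyProj e _)
  proj_neg _ he _ := Subtype.ext (polyProj_of_neg he _)
  proj_X_smul e i _ := Subtype.ext (polyProj_X_mul e i _)

/-- Elements of `J : x_j` are torsion modulo `J` with respect to all variables. -/
def IsTorsionColon (J : Ideal (MvPolynomial (Fin n) k)) (j : Fin n) : Prop :=
  ∀ f, X j * f ∈ J → ∀ i, ∃ r : ℕ, X i ^ r * f ∈ J

/-- The kernel of multiplication by x_j on S/I is (I : x_j)/I, so `IsTorsionColon` is exactly the
torsion required on the left. -/
theorem isAlmostShortExact_X {j : Fin n} (hI : I.IsHomogeneous (homogeneousSubmodule (Fin n) k))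
    (hJ : J.IsHomogeneous (homogeneousSubmodule (Fin n) k)) (h : J = I ⊔ Ideal.span {X j})
    (ht : IsTorsionColon I j) :
    (quotientProjections hI).IsAlmostShortExact (quotientProjections hI) (quotientProjections hJ)
      (LinearMap.lsmul _ _ (X j)) (Submodule.factor (h ▸ le_sup_left : I ≤ J)) 1 where
  left := GradingProjections.isHomogeneousMap_X_smul _ _
  right e m := by
    obtain ⟨f, rfl⟩ := Ideal.Quotient.mk_surjective m
    rfl
  exact m := by
    obtain ⟨f, rfl⟩ := Ideal.Quotient.mk_surjective m
    have h1 : Submodule.factor (h ▸ le_sup_left : I ≤ J) (Ideal.Quotient.mk I f) = 0 ↔ f ∈ J :=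
      Ideal.Quotient.eq_zero_iff_mem
    rw [h1]
    subst h
    constructor
    · intro hf
      obtain ⟨a, ha, b, hb, rfl⟩ := Submodule.mem_sup.1 hf
      obtain ⟨c, rfl⟩ := Ideal.mem_span_singleton'.1 hb
      refine ⟨Ideal.Quotient.mk I c, ?_⟩
      show Ideal.Quotient.mk I (X j * c) = _
      rw [Ideal.Quotient.eq, mul_comm, add_comm, ← sub_sub, sub_self, zero_sub]
      exact neg_mem ha
    · rintro ⟨m, hm⟩
      obtain ⟨c, rfl⟩ := Ideal.Quotient.mk_surjective m
      have : X j * c - f ∈ I := Ideal.Quotient.eq.1 hm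
      rw [← sub_sub_cancel (X j * c) f]
      exact sub_mem (Ideal.mul_mem_right _ _ (Ideal.mem_sup_right (Ideal.mem_span_singleton_self _)))
        (Ideal.mem_sup_left this)
  surjective := Submodule.factor_surjective _
  torsion m hm i := by
    obtain ⟨f, rfl⟩ := Ideal.Quotient.mk_surjective m
    obtain ⟨r, hr⟩ := ht f (Ideal.Quotient.eq_zero_iff_mem.1 hm) i
    exact ⟨r, Ideal.Quotient.eq_zero_iff_mem.2 hr⟩

theorem isHomogeneous_bot :
    (⊥ : Ideal (MvPolynomial (Fin n) k)).IsHomogeneous (homogeneousSubmodule (Fin n) k) :=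
  Ideal.IsHomogeneous.bot _

/-- The ring S appears as S/⊥, so that the results on graded quotients apply to it. -/
theorem isAlmostShortExact_ideal (hI : I.IsHomogeneous (homogeneousSubmodule (Fin n) k)) :
    (idealProjections hI).IsAlmostShortExact (quotientProjections isHomogeneous_bot)
      (quotientProjections hI) (Submodule.mkQ ⊥ ∘ₗ I.subtype) (Submodule.factor bot_le) 0 where
  left e m := by rw [add_zero]; rfl
  right e m := by
    obtain ⟨f, rfl⟩ := Ideal.Quotient.mk_surjective m
    rfl
  exact m := by
    obtain ⟨f, rfl⟩ := Ideal.Quotient.mk_surjective m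
    have h1 : Submodule.factor (bot_le : ⊥ ≤ I) (Ideal.Quotient.mk ⊥ f) = 0 ↔ f ∈ I :=
      Ideal.Quotient.eq_zero_iff_mem
    rw [h1]
    constructor
    · exact fun hf => ⟨⟨f, hf⟩, rfl⟩
    · rintro ⟨m, hm⟩
      have : (m : MvPolynomial (Fin n) k) - f ∈ (⊥ : Ideal (MvPolynomial (Fin n) k)) :=
        Ideal.Quotient.eq.1 hm
      rw [Ideal.mem_bot, sub_eq_zero] at this
      exact this ▸ m.2
  surjective := Submodule.factor_surjective _
  torsion m hm i := by
    refine ⟨0, ?_⟩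
    have : (m : MvPolynomial (Fin n) k) ∈ (⊥ : Ideal (MvPolynomial (Fin n) k)) :=
      Ideal.Quotient.eq_zero_iff_mem.1 hm
    rw [Ideal.mem_bot] at this
    rw [pow_zero, one_smul]
    exact Subtype.ext this

/-- The degrees in which `(J : x_j) / J` does not vanish. -/
def colonDegrees (J : Ideal (MvPolynomial (Fin n) k)) (j : Fin n) : Set ℤ :=
  {d | ∃ f, polyProj d f = f ∧ X j * f ∈ J ∧ f ∉ J}

/-- The last nonzero multiple of a torsion element by a power of x_j lies in (J : x_j)/J. With
`colonDegrees_subset`, this reads off the top degree of H^0 from the colon module. -/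
theorem exists_colonDegrees (hJ : J.IsHomogeneous (homogeneousSubmodule (Fin n) k)) (j : Fin n)
    {d : ℤ} (hd : d ∈ nonvanishingDegrees k n (quotientGrading J) 0) :
    ∃ d', d ≤ d' ∧ d' ∈ colonDegrees J j := by
  obtain ⟨d', hd', m, hm, hmd, hX⟩ := (quotientProjections hJ).exists_X_smul_eq_zero j hd
  obtain ⟨f, rfl⟩ := Ideal.Quotient.mk_surjective m
  refine ⟨d', hd', polyProj d' f, polyProj_polyProj _ _, ?_, fun h => hm ?_⟩
  · rw [← polyProj_X_mul]
    exact polyProj_mem hJ _ (Ideal.Quotient.eq_zero_iff_mem.1 hX)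
  · rw [← hmd]
    exact Ideal.Quotient.eq_zero_iff_mem.2 h

theorem colonDegrees_subset (hJ : J.IsHomogeneous (homogeneousSubmodule (Fin n) k)) {j : Fin n}
    (ht : IsTorsionColon J j) :
    colonDegrees J j ⊆ nonvanishingDegrees k n (quotientGrading J) 0 := by
  rintro d ⟨f, hfd, hX, hf⟩
  refine (quotientProjections hJ).mem_nonvanishingDegrees_zero_iff.2
    ⟨Ideal.Quotient.mk J f, ?_, ?_, fun i => ?_⟩
  · rwa [ne_eq, Ideal.Quotient.eq_zero_iff_mem]
  · rw [quotientProjections_proj_mk, hfd]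
  · obtain ⟨r, hr⟩ := ht f hX i
    exact ⟨r, Ideal.Quotient.eq_zero_iff_mem.2 hr⟩

end Gradings

/-! ### Vanishing above degree n -/

section Vanishing

variable {k : Type*} [Field k] {n : ℕ} {A : Type*}
  [AddCommGroup A] [Module (MvPolynomial (Fin n) k) A] {𝓐 : ℕ → AddSubgroup A}

theorem GradingProjections.le_of_mem_nonvanishingDegrees (P : GradingProjections k n 𝓐) {p : ℕ}
    {d : ℤ} (hd : d ∈ nonvanishingDegrees k n 𝓐 p) : p ≤ n := by
  by_contra! hp
  obtain ⟨φ, hφ, -, hne⟩ := P.mem_nonvanishingDegrees_iff.1 hd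
  refine hne 0 ?_
  rw [map_zero]
  ext J
  refine (apply_eq_zero hφ ?_).symm
  have := J.card_le_univ
  rw [Fintype.card_fin] at this
  omega

end Vanishing

/-! ### Ideals of last variables and the cohomology of S -/

section LastVariables

variable {k : Type*} [Field k] {n : ℕ}

variable (k n) in
/-- The ideal generated by the last `s` variables. -/
def lastVariables (s : ℕ) : Ideal (MvPolynomial (Fin n) k) :=
  Ideal.span (X '' {j : Fin n | (j.rev : ℕ) < s})

theorem lastVariables_zero : lastVariables k n 0 = ⊥ := by
  simp [lastVariables]

theorem lastVariables_succ (j : Fin n) :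
    lastVariables k n (j.rev + 1) = lastVariables k n j.rev ⊔ Ideal.span {X j} := by
  rw [lastVariables, lastVariables, ← Ideal.span_union, ← Set.image_singleton, ← Set.image_union]
  congr 2
  ext i
  simp only [Set.mem_ofPred_eq, Set.mem_union, Set.mem_singleton_iff, Nat.lt_succ_iff_lt_or_eq,
    Fin.val_inj, Fin.rev_inj]

theorem mem_lastVariables {s : ℕ} {f : MvPolynomial (Fin n) k} :
    f ∈ lastVariables k n s ↔ ∀ a ∈ f.support, ∃ j : Fin n, (j.rev : ℕ) < s ∧ a j ≠ 0 := by
  rw [lastVariables, mem_ideal_span_X_image]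
  rfl

theorem X_mem_lastVariables {s : ℕ} {j : Fin n} (hj : (j.rev : ℕ) < s) :
    X j ∈ lastVariables k n s :=
  Ideal.subset_span ⟨j, hj, rfl⟩

theorem isHomogeneous_lastVariables (s : ℕ) :
    (lastVariables k n s).IsHomogeneous (homogeneousSubmodule (Fin n) k) := by
  refine Ideal.homogeneous_span _ _ ?_
  rintro _ ⟨j, -, rfl⟩
  exact ⟨1, isHomogeneous_X k j⟩

theorem isHomogeneous_sup_lastVariables {I : Ideal (MvPolynomial (Fin n) k)}
    (hI : I.IsHomogeneous (homogeneousSubmodule (Fin n) k)) (s : ℕ) :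
    (I ⊔ lastVariables k n s).IsHomogeneous (homogeneousSubmodule (Fin n) k) :=
  hI.sup (isHomogeneous_lastVariables s)

theorem mem_lastVariables_of_X_mul_mem {j : Fin n} {f : MvPolynomial (Fin n) k}
    (hf : X j * f ∈ lastVariables k n j.rev) : f ∈ lastVariables k n j.rev := by
  rw [mem_lastVariables] at hf ⊢
  intro a ha
  obtain ⟨i, hi, h⟩ := hf (Finsupp.single j 1 + a) (by
    rw [support_X_mul, Finset.mem_map]; exact ⟨a, ha, rfl⟩)
  refine ⟨i, hi, fun h0 => h ?_⟩
  have : j ≠ i := fun h => by subst h; exact lt_irrefl _ hi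
  simp [h0, this]

/-- The local cohomology of `S` vanishes below the top degree. -/
theorem le_of_mem_nonvanishingDegrees_bot {p : ℕ} {d : ℤ}
    (hd : d ∈ nonvanishingDegrees k n
      (quotientGrading (⊥ : Ideal (MvPolynomial (Fin n) k))) p) : n ≤ p := by
  -- Generalized to S modulo the last s variables, in which the next variable is a nonzerodivisor; p
  -- drops by one as s rises by one.
  suffices H : ∀ p s : ℕ, p + s < n → ∀ d,
      d ∉ nonvanishingDegrees k n (quotientGrading (lastVariables k n s)) p by
    by_contra! hp
    rw [← lastVariables_zero] at hd
    exact H p 0 hp d hd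
  intro p
  induction p with
  | zero =>
    intro s hs d hd
    have hrev : (((⟨s, by omega⟩ : Fin n).rev.rev : Fin n) : ℕ) = s := by simp
    set j : Fin n := (⟨s, by omega⟩ : Fin n).rev
    rw [← hrev] at hd
    obtain ⟨d', -, f, -, hX, hf⟩ := exists_colonDegrees (isHomogeneous_lastVariables _) j hd
    exact hf (mem_lastVariables_of_X_mul_mem hX)
  | succ p ih =>
    intro s hs d hd
    have hrev : (((⟨s, by omega⟩ : Fin n).rev.rev : Fin n) : ℕ) = s := by simp
    set j : Fin n := (⟨s, by omega⟩ : Fin n).rev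
    rw [← hrev] at hd
    obtain ⟨d', -, hd'⟩ := (isAlmostShortExact_X (isHomogeneous_lastVariables _)
      (isHomogeneous_lastVariables _) (lastVariables_succ (k := k) j) (fun f hf i =>
        ⟨0, by simpa using mem_lastVariables_of_X_mul_mem hf⟩)).exists_mem_right hd
    exact ih _ (by omega) _ hd'

end LastVariables

/-! ### Descent of domination along the variables -/

section Domination

variable {k : Type*} [Field k] {n : ℕ} {I I' : Ideal (MvPolynomial (Fin n) k)}

/-- Every nonvanishing degree of a local cohomology module of `S / I` is bounded by one of
`S / I'`, with the weight `w` given to the cohomological degree. -/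
def Dominates (w : ℤ) (I I' : Ideal (MvPolynomial (Fin n) k)) : Prop :=
  ∀ t i : ℕ, i ≤ t → ∀ d ∈ nonvanishingDegrees k n (quotientGrading I) i,
    ∃ i' ≤ t, ∃ d' ∈ nonvanishingDegrees k n (quotientGrading I') i', d + w * i ≤ d' + w * i'

/-- Positive cohomology is pushed down to S/J, compared there with S/J', and pulled back to S/I';
H^0 is handled by the colon degrees. -/
theorem Dominates.of_sup_X {w : ℤ} (hw : w ≤ 1) {J J' : Ideal (MvPolynomial (Fin n) k)} {j : Fin n}
    (hI : I.IsHomogeneous (homogeneousSubmodule (Fin n) k))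
    (hJ : J.IsHomogeneous (homogeneousSubmodule (Fin n) k))
    (hI' : I'.IsHomogeneous (homogeneousSubmodule (Fin n) k))
    (hJ' : J'.IsHomogeneous (homogeneousSubmodule (Fin n) k))
    (h : J = I ⊔ Ideal.span {X j}) (h' : J' = I' ⊔ Ideal.span {X j})
    (ht : IsTorsionColon I j) (ht' : IsTorsionColon I' j)
    (hc : colonDegrees I j ⊆ colonDegrees I' j) (H : Dominates w J J') : Dominates w I I' := by
  intro t i hi d hd
  obtain _ | i := i
  · obtain ⟨d', hle, hd'⟩ := exists_colonDegrees hI j hd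
    exact ⟨0, hi, d', colonDegrees_subset hI' ht' (hc hd'), by simpa using hle⟩
  · obtain ⟨d', hle, hd'⟩ := (isAlmostShortExact_X hI hJ h ht).exists_mem_right hd
    obtain ⟨i', hi', d'', hd'', hle'⟩ := H (t - 1) i (by omega) _ hd'
    push_cast
    rcases (isAlmostShortExact_X hI' hJ' h' ht').mem_or_mem_of_mem_right hd'' with hm | hm
    -- Going down raised the degree by 1 and lowered i by 1. Here neither is undone, so the weighted
    -- value changed by 1 - w, which w ≤ 1 makes harmless; in the other case both are undone.
    · exact ⟨i', by omega, d'', hm, by linarith⟩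
    · refine ⟨i' + 1, by omega, d'' - 1, hm, ?_⟩
      push_cast
      linarith

theorem Dominates.of_colonDegrees {w : ℤ} (hw : w ≤ 1)
    (hI : I.IsHomogeneous (homogeneousSubmodule (Fin n) k))
    (hI' : I'.IsHomogeneous (homogeneousSubmodule (Fin n) k))
    (ht : ∀ j : Fin n, IsTorsionColon (I ⊔ lastVariables k n j.rev) j)
    (ht' : ∀ j : Fin n, IsTorsionColon (I' ⊔ lastVariables k n j.rev) j)
    (hc : ∀ j : Fin n, colonDegrees (I ⊔ lastVariables k n j.rev) j ⊆
      colonDegrees (I' ⊔ lastVariables k n j.rev) j)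
    (hn : I ⊔ lastVariables k n n = I' ⊔ lastVariables k n n) : Dominates w I I' := by
  suffices H : ∀ s ≤ n, Dominates w (I ⊔ lastVariables k n s) (I' ⊔ lastVariables k n s) by
    simpa [lastVariables_zero] using H 0 (Nat.zero_le n)
  intro s hs
  induction hs using Nat.decreasingInduction with
  | self =>
    rw [hn]
    exact fun t i hi d hd => ⟨i, hi, d, hd, le_rfl⟩
  | of_succ s hs ih =>
    have hrev : (((⟨s, hs⟩ : Fin n).rev.rev : Fin n) : ℕ) = s := by simp
    set j : Fin n := (⟨s, hs⟩ : Fin n).rev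
    rw [← hrev] at ih ⊢
    refine Dominates.of_sup_X hw (isHomogeneous_sup_lastVariables hI _)
      (isHomogeneous_sup_lastVariables hI _) (isHomogeneous_sup_lastVariables hI' _)
      (isHomogeneous_sup_lastVariables hI' _) ?_ ?_ (ht j) (ht' j) (hc j) ih
    · rw [lastVariables_succ, sup_assoc]
    · rw [lastVariables_succ, sup_assoc]

end Domination

/-! ### The reverse lexicographic order -/

section Revlex

variable {n : ℕ}

/-- An order embedding of the exponent vectors, ordered reverse lexicographically, into a linear
order. -/
def revlexKey (a : Fin n →₀ ℕ) : Lex (ℕ × Colex (Fin n → ℕᵒᵈ)) :=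
  toLex (a.degree, toColex fun i => OrderDual.toDual (a i))

theorem revlexLT_iff {a b : Fin n →₀ ℕ} : RevlexLT a b ↔ revlexKey a < revlexKey b := by
  rw [Prod.Lex.lt_iff]
  rfl

theorem revlexKey_injective : Function.Injective (revlexKey (n := n)) := by
  intro a b h
  have := congrArg (fun x => ofColex (ofLex x).2) h
  ext i
  exact OrderDual.toDual.injective (congrFun this i)

theorem revlexLT_add_left_iff {a b : Fin n →₀ ℕ} (c : Fin n →₀ ℕ) :
    RevlexLT (c + a) (c + b) ↔ RevlexLT a b := by
  simp [RevlexLT]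

theorem finite_degree_eq (d : ℕ) : {a : Fin n →₀ ℕ | a.degree = d}.Finite := by
  exact (Finsupp.finite_of_degree_le (σ := Fin n) d).subset fun a ha => le_of_eq ha

end Revlex

/-! ### Initial ideals, last variables and colons -/

section InitialExponents

variable {k : Type*} [Field k] {n : ℕ} {f : MvPolynomial (Fin n) k} {a : Fin n →₀ ℕ}
  {I J : Ideal (MvPolynomial (Fin n) k)}

theorem exists_isInitialExponent (hf : f ≠ 0) : ∃ a, IsInitialExponent f a := by
  obtain ⟨a, ha, h⟩ := f.support.exists_max_image revlexKey (support_nonempty.2 hf)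
  refine ⟨a, ha, fun b hb hne => ?_⟩
  rw [revlexLT_iff]
  exact lt_of_le_of_ne (h b hb) fun h => hne (revlexKey_injective h)

theorem mem_support_monomial_mul {c b : Fin n →₀ ℕ} :
    b ∈ (monomial c 1 * f).support ↔ ∃ a ∈ f.support, b = c + a := by
  rw [mem_support_iff, coeff_monomial_mul']
  constructor
  · intro h
    split_ifs at h with hc
    · rw [one_mul] at h
      exact ⟨b - c, mem_support_iff.2 h, (add_tsub_cancel_of_le hc).symm⟩
    · exact absurd rfl h
  · rintro ⟨a, ha, rfl⟩
    rw [if_pos le_self_add, one_mul, add_tsub_cancel_left]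
    exact mem_support_iff.1 ha

theorem IsInitialExponent.monomial_mul (h : IsInitialExponent f a) (c : Fin n →₀ ℕ) :
    IsInitialExponent (monomial c 1 * f) (c + a) := by
  refine ⟨mem_support_monomial_mul.2 ⟨a, h.1, rfl⟩, fun b hb hne => ?_⟩
  obtain ⟨b, hb', rfl⟩ := mem_support_monomial_mul.1 hb
  rw [revlexLT_add_left_iff]
  exact h.2 b hb' fun h => hne (by rw [h])

theorem isInitialExponent_monomial (a : Fin n →₀ ℕ) :
    IsInitialExponent (monomial a (1 : k)) a := by
  have hs : (monomial a (1 : k)).support = {a} := by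
    classical
    rw [support_monomial, if_neg one_ne_zero]
  refine ⟨by rw [hs]; exact Finset.mem_singleton_self a, fun b hb hne => ?_⟩
  rw [hs] at hb
  exact absurd (Finset.mem_singleton.1 hb) hne

theorem polyProj_eq_self_iff {d : ℤ} :
    polyProj d f = f ↔ ∀ b ∈ f.support, (b.degree : ℤ) = d := by
  rw [MvPolynomial.ext_iff]
  refine forall_congr' fun b => ?_
  rw [coeff_polyProj, mem_support_iff]
  by_cases h : (b.degree : ℤ) = d <;> simp [h, eq_comm]

theorem mem_support_polyProj {d : ℤ} {b : Fin n →₀ ℕ} :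
    b ∈ (polyProj d f).support ↔ (b.degree : ℤ) = d ∧ b ∈ f.support := by
  rw [mem_support_iff, coeff_polyProj, mem_support_iff]
  by_cases h : (b.degree : ℤ) = d <;> simp [h]

/-- The exponents of the initial monomials of the elements of `I`. -/
def initialExponents (I : Ideal (MvPolynomial (Fin n) k)) : Set (Fin n →₀ ℕ) :=
  {a | ∃ f ∈ I, IsInitialExponent f a}

theorem add_mem_initialExponents (h : a ∈ initialExponents I) (c : Fin n →₀ ℕ) :
    c + a ∈ initialExponents I := by
  obtain ⟨f, hf, hfa⟩ := h
  exact ⟨_, I.mul_mem_left _ hf, hfa.monomial_mul c⟩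

theorem mem_initialExponents_of_monomial_mem (h : monomial a 1 ∈ I) :
    a ∈ initialExponents I :=
  ⟨_, h, isInitialExponent_monomial a⟩

theorem exists_homogeneous_of_mem_initialExponents
    (hI : I.IsHomogeneous (homogeneousSubmodule (Fin n) k)) (h : a ∈ initialExponents I) :
    ∃ f ∈ I, polyProj a.degree f = f ∧ IsInitialExponent f a := by
  obtain ⟨f, hf, hfa⟩ := h
  refine ⟨polyProj a.degree f, polyProj_mem hI _ hf, polyProj_polyProj _ _,
    mem_support_polyProj.2 ⟨rfl, hfa.1⟩, fun b hb hne => ?_⟩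
  exact hfa.2 b (mem_support_polyProj.1 hb).2 hne

theorem mem_initialIdeal_iff :
    f ∈ initialIdeal I ↔ ∀ a ∈ f.support, a ∈ initialExponents I := by
  have : initialIdeal I =
      Ideal.span ((fun a => monomial a (1 : k)) '' initialExponents I) := by
    rw [initialIdeal]
    congr 1
    ext m
    constructor
    · rintro ⟨f, hf, a, ha, rfl⟩
      exact ⟨a, ⟨f, hf, ha⟩, rfl⟩
    · rintro ⟨a, ⟨f, hf, ha⟩, rfl⟩
      exact ⟨f, hf, a, ha, rfl⟩
  rw [this, mem_ideal_span_monomial_image]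
  refine forall₂_congr fun b _ => ⟨?_, fun h => ⟨b, h, le_rfl⟩⟩
  rintro ⟨a, ha, hab⟩
  rw [← tsub_add_cancel_of_le hab]
  exact add_mem_initialExponents ha _

theorem monomial_mem_initialIdeal_iff :
    monomial a 1 ∈ initialIdeal I ↔ a ∈ initialExponents I := by
  classical
  rw [mem_initialIdeal_iff, support_monomial, if_neg one_ne_zero]
  simp

theorem isHomogeneous_initialIdeal :
    (initialIdeal I).IsHomogeneous (homogeneousSubmodule (Fin n) k) := by
  refine Ideal.homogeneous_span _ _ ?_
  rintro _ ⟨f, -, a, -, rfl⟩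
  exact ⟨a.degree, isHomogeneous_monomial _ rfl⟩

theorem initialExponents_mono (h : I ≤ J) : initialExponents I ⊆ initialExponents J :=
  fun _ ⟨f, hf, hfa⟩ => ⟨f, h hf, hfa⟩

theorem initialIdeal_bot : initialIdeal (⊥ : Ideal (MvPolynomial (Fin n) k)) = ⊥ := by
  refine Ideal.span_eq_bot.2 ?_
  rintro _ ⟨f, hf, a, ha, rfl⟩
  rw [Ideal.mem_bot] at hf
  subst hf
  simpa using ha.1

theorem initialIdeal_ne_bot (hI : I ≠ ⊥) : initialIdeal I ≠ ⊥ := by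
  obtain ⟨f, hf, hf0⟩ := Submodule.exists_mem_ne_zero_of_ne_bot hI
  obtain ⟨a, ha⟩ := exists_isInitialExponent hf0
  intro h
  have : monomial a (1 : k) ∈ initialIdeal I := monomial_mem_initialIdeal_iff.2 ⟨f, hf, ha⟩
  rw [h, Ideal.mem_bot, monomial_eq_zero] at this
  exact one_ne_zero this

theorem monomial_mem_lastVariables {s : ℕ} {j : Fin n} (hj : (j.rev : ℕ) < s) (ha : a j ≠ 0) :
    monomial a (1 : k) ∈ lastVariables k n s := by
  classical
  rw [mem_lastVariables, support_monomial, if_neg one_ne_zero]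
  intro b hb
  rw [Finset.mem_singleton.1 hb]
  exact ⟨j, hj, ha⟩

/-- Taking initial ideals commutes with adding the last variables. -/
theorem initialIdeal_sup_lastVariables (hI : I.IsHomogeneous (homogeneousSubmodule (Fin n) k))
    (s : ℕ) : initialIdeal (I ⊔ lastVariables k n s) = initialIdeal I ⊔ lastVariables k n s := by
  apply le_antisymm
  · refine Ideal.span_le.2 ?_
    rintro _ ⟨h', hh', a, ha', rfl⟩
    obtain ⟨h, hh, hhom, ha⟩ := exists_homogeneous_of_mem_initialExponents
      (isHomogeneous_sup_lastVariables hI s) ⟨h', hh', ha'⟩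
    by_cases hlast : ∃ j : Fin n, (j.rev : ℕ) < s ∧ a j ≠ 0
    · obtain ⟨j, hj, haj⟩ := hlast
      exact Ideal.mem_sup_right (monomial_mem_lastVariables hj haj)
    push Not at hlast
    refine Ideal.mem_sup_left (monomial_mem_initialIdeal_iff.2 ?_)
    obtain ⟨g, hg, r, hr, rfl⟩ := Submodule.mem_sup.1 hh
    have hr0 : ∀ b, b ∈ r.support → ∃ j : Fin n, (j.rev : ℕ) < s ∧ b j ≠ 0 :=
      mem_lastVariables.1 hr
    have hra : coeff a r = 0 := by
      by_contra h0
      obtain ⟨j, hj, haj⟩ := hr0 a (mem_support_iff.2 h0)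
      exact haj (hlast j hj)
    refine ⟨polyProj a.degree g, polyProj_mem hI _ hg, mem_support_polyProj.2 ⟨rfl, ?_⟩, ?_⟩
    · have := mem_support_iff.1 ha.1
      rw [coeff_add, hra, add_zero] at this
      exact mem_support_iff.2 this
    · intro b hb hne
      obtain ⟨hdeg, hb⟩ := mem_support_polyProj.1 hb
      -- A monomial of r contains one of the last s variables and x^a contains none, so in equal
      -- degree revlex places it below x^a.
      by_cases hbr : b ∈ r.support
      · obtain ⟨j, hj, hbj⟩ := hr0 b hbr
        have hdeg' : b.degree = a.degree := by exact_mod_cast hdeg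
        rw [revlexLT_iff]
        refine lt_of_not_ge fun hle => ?_
        rcases hle.lt_or_eq with hlt | heq
        · rw [← revlexLT_iff] at hlt
          rcases hlt with hlt | ⟨-, i, hi, hlt⟩
          · omega
          · have hij : j ≤ i := by
              by_contra! hij
              exact hbj ((hi j hij).symm.trans (hlast j hj))
            have := hlast i (lt_of_le_of_lt (Fin.rev_le_rev.2 hij) hj)
            omega
        · exact hne (revlexKey_injective heq).symm
      · refine ha.2 b ?_ hne
        rw [mem_support_iff, coeff_add, notMem_support_iff.1 hbr, add_zero]
        exact mem_support_iff.1 hb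
  · refine sup_le ?_ (Ideal.span_le.2 ?_)
    · exact fun f hf => mem_initialIdeal_iff.2 fun a ha =>
        initialExponents_mono le_sup_left (mem_initialIdeal_iff.1 hf a ha)
    · rintro _ ⟨j, hj, rfl⟩
      exact monomial_mem_initialIdeal_iff.2 (mem_initialExponents_of_monomial_mem
        (Ideal.mem_sup_right (X_mem_lastVariables hj)))

/-- If `J` contains the variables following `x_j` then every monomial of `in(J) : x_j` is the
initial monomial of a homogeneous element of `J : x_j`. -/
theorem exists_mem_colon {j : Fin n} (hJ : J.IsHomogeneous (homogeneousSubmodule (Fin n) k))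
    (hlast : lastVariables k n j.rev ≤ J) (ha : Finsupp.single j 1 + a ∈ initialExponents J) :
    ∃ f, X j * f ∈ J ∧ polyProj a.degree f = f ∧ IsInitialExponent f a := by
  -- If x^a contains a variable after x_j, it lies in J itself; otherwise an element of J with
  -- initial monomial x_j x^a is divided by x_j.
  by_cases hz : ∃ i : Fin n, j < i ∧ a i ≠ 0
  · obtain ⟨i, hi, hai⟩ := hz
    refine ⟨monomial a 1, J.mul_mem_left _ (hlast (monomial_mem_lastVariables
      (Fin.rev_lt_rev.2 hi) hai)), ?_, isInitialExponent_monomial a⟩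
    classical
    rw [polyProj_eq_self_iff, support_monomial, if_neg one_ne_zero]
    simp
  push Not at hz
  obtain ⟨h, hh, hhom, hin⟩ := exists_homogeneous_of_mem_initialExponents hJ ha
  rw [polyProj_eq_self_iff] at hhom
  have hcoeff : ∀ b, b ∈ (h.divMonomial (Finsupp.single j 1)).support ↔
      Finsupp.single j 1 + b ∈ h.support := fun b => by
    rw [mem_support_iff, coeff_divMonomial, mem_support_iff]
  refine ⟨h.divMonomial (Finsupp.single j 1), ?_, ?_, (hcoeff a).2 hin.1, fun b hb hne => ?_⟩
  -- The remainder lies in J: its monomials omit x_j, have the degree of x_j x^a and are revlex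
  -- smaller, so each contains a variable after x_j.
  · rw [eq_sub_of_add_eq (divMonomial_add_modMonomial_single h j)]
    refine sub_mem hh (hlast (mem_lastVariables.2 fun b hb => ?_))
    have hbj : b j = 0 := by
      by_contra h0
      rw [mem_support_iff] at hb
      refine hb (coeff_modMonomial_of_le _ ?_)
      rw [Finsupp.single_le_iff]
      omega
    have hbs : b ∈ h.support := by
      rw [mem_support_iff] at hb ⊢
      rwa [coeff_modMonomial_of_not_le] at hb
      rw [Finsupp.single_le_iff]
      omega
    have hne : b ≠ Finsupp.single j 1 + a := by
      rintro rfl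
      simp at hbj
    rcases hin.2 b hbs hne with hlt | ⟨-, i, hi, hlt⟩
    · have := hhom b hbs
      omega
    · refine ⟨i, ?_, by omega⟩
      have hij : j < i := by
        rcases lt_trichotomy i j with hij | rfl | hij
        · have := hi j hij
          rw [hbj] at this
          simp at this
          omega
        · omega
        · exact hij
      exact Fin.rev_lt_rev.2 hij
  · rw [polyProj_eq_self_iff]
    intro b hb
    have := hhom _ ((hcoeff b).1 hb)
    simp only [map_add] at this
    push_cast at this
    omega
  · have := hin.2 _ ((hcoeff b).1 hb) fun h => hne (add_left_cancel h)
    rwa [revlexLT_add_left_iff] at this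

/-- Some monomial of f lies outside in(J); its lift to J : x_j then cannot lie in J. -/
theorem colonDegrees_initialIdeal_subset {j : Fin n}
    (hJ : J.IsHomogeneous (homogeneousSubmodule (Fin n) k))
    (hlast : lastVariables k n j.rev ≤ J) :
    colonDegrees (initialIdeal J) j ⊆ colonDegrees J j := by
  rintro d ⟨f, hfd, hX, hf⟩
  rw [mem_initialIdeal_iff] at hf
  push Not at hf
  obtain ⟨a, ha, haJ⟩ := hf
  have had : (a.degree : ℤ) = d := polyProj_eq_self_iff.1 hfd a ha
  obtain ⟨g, hg, hgd, hga⟩ := exists_mem_colon hJ hlast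
    (mem_initialIdeal_iff.1 hX _ (mem_support_monomial_mul.2 ⟨a, ha, rfl⟩))
  exact ⟨g, had ▸ hgd, hg, fun h => haJ ⟨g, h, hga⟩⟩

/-- Among the elements of (J : x_j) \ J of degree d, take one with smallest initial monomial. That
monomial is not in in(J), since otherwise subtracting a multiple of an element of J would make it
smaller. -/
theorem colonDegrees_subset_initialIdeal {j : Fin n}
    (hJ : J.IsHomogeneous (homogeneousSubmodule (Fin n) k)) :
    colonDegrees J j ⊆ colonDegrees (initialIdeal J) j := by
  rintro d ⟨f₀, hfd₀, hX₀, hf₀⟩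
  let T : Set (Fin n →₀ ℕ) :=
    {a | ∃ f, polyProj d f = f ∧ X j * f ∈ J ∧ f ∉ J ∧ IsInitialExponent f a}
  have hfin : T.Finite := by
    refine (finite_degree_eq d.toNat).subset ?_
    rintro a ⟨f, hfd, -, -, ha⟩
    have := polyProj_eq_self_iff.1 hfd a ha.1
    show a.degree = _
    omega
  have hne : T.Nonempty := by
    obtain ⟨a, ha⟩ := exists_isInitialExponent (f := f₀) fun h => hf₀ (h ▸ zero_mem J)
    exact ⟨a, f₀, hfd₀, hX₀, hf₀, ha⟩
  obtain ⟨a, ⟨f, hfd, hX, hf, ha⟩, hmin⟩ := Set.exists_min_image T revlexKey hfin hne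
  have had : (a.degree : ℤ) = d := polyProj_eq_self_iff.1 hfd a ha.1
  have haJ : a ∉ initialExponents J := by
    intro haJ
    obtain ⟨g, hg, hgd, hga⟩ := exists_homogeneous_of_mem_initialExponents hJ haJ
    rw [had] at hgd
    let f' := f - C (coeff a f / coeff a g) * g
    have hf' : f' ∉ J := fun h => hf (by
      simpa [f'] using add_mem h (J.mul_mem_left (C (coeff a f / coeff a g)) hg))
    have hsupp : ∀ b ∈ f'.support, b ≠ a ∧ (b ∈ f.support ∨ b ∈ g.support) := by
      intro b hb
      simp only [f', mem_support_iff, coeff_sub, coeff_C_mul] at hb ⊢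
      refine ⟨?_, ?_⟩
      · rintro rfl
        rw [div_mul_cancel₀ _ (mem_support_iff.1 hga.1), sub_self] at hb
        exact hb rfl
      · by_contra! h
        rw [h.1, h.2, mul_zero, sub_zero] at hb
        exact hb rfl
    obtain ⟨b, hb⟩ := exists_isInitialExponent (f := f') fun h => hf' (h ▸ zero_mem J)
    have hbT : b ∈ T := by
      refine ⟨f', ?_, ?_, hf', hb⟩
      · rw [polyProj_eq_self_iff] at hfd hgd ⊢
        intro c hc
        rcases (hsupp c hc).2 with h | h
        exacts [hfd c h, hgd c h]
      · rw [mul_sub]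
        exact sub_mem hX (J.mul_mem_left _ (J.mul_mem_left _ hg))
    have hlt : RevlexLT b a := by
      obtain ⟨hba, h | h⟩ := hsupp b hb.1
      exacts [ha.2 b h hba, hga.2 b h hba]
    exact absurd (hmin b hbT) (not_le.2 (revlexLT_iff.1 hlt))
  refine ⟨monomial a 1, ?_, ?_, fun h => haJ (monomial_mem_initialIdeal_iff.1 h)⟩
  · classical
    rw [polyProj_eq_self_iff, support_monomial, if_neg one_ne_zero]
    simpa using had
  · have : X j * monomial a (1 : k) = monomial (Finsupp.single j 1 + a) 1 := by
      rw [X, monomial_mul, one_mul]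
    rw [this, monomial_mem_initialIdeal_iff]
    exact ⟨_, hX, ha.monomial_mul _⟩

/-- Each monomial of in(J) : x_j lifts to J : x_j; a power of x_i carries the lift into J, hence its
initial monomial into in(J). -/
theorem IsTorsionColon.initialIdeal {j : Fin n}
    (hJ : J.IsHomogeneous (homogeneousSubmodule (Fin n) k))
    (hlast : lastVariables k n j.rev ≤ J) (h : IsTorsionColon J j) :
    IsTorsionColon (initialIdeal J) j := by
  intro f hf i
  have key : ∀ a ∈ f.support, ∃ r₀ : ℕ, ∀ r, r₀ ≤ r →
      Finsupp.single i r + a ∈ initialExponents J := by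
    intro a ha
    obtain ⟨g, hg, -, hga⟩ := exists_mem_colon hJ hlast
      (mem_initialIdeal_iff.1 hf _ (mem_support_monomial_mul.2 ⟨a, ha, rfl⟩))
    obtain ⟨r₀, hr₀⟩ := h g hg i
    refine ⟨r₀, fun r hr => ⟨monomial (Finsupp.single i r) 1 * g, ?_, hga.monomial_mul _⟩⟩
    rw [← X_pow_eq_monomial, ← Nat.sub_add_cancel hr, pow_add, mul_assoc]
    exact J.mul_mem_left _ hr₀
  choose! r hr using key
  refine ⟨f.support.sup r, ?_⟩
  rw [X_pow_eq_monomial, mem_initialIdeal_iff]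
  intro b hb
  obtain ⟨a, ha, rfl⟩ := mem_support_monomial_mul.1 hb
  exact hr a ha _ (Finset.le_sup ha)

/-- All nonconstant monomials lie in J, so only constants need checking, and a homogeneous element
with initial monomial 1 is a unit. -/
theorem initialIdeal_eq_self_of_le (hJ : J.IsHomogeneous (homogeneousSubmodule (Fin n) k))
    (hlast : lastVariables k n n ≤ J) : initialIdeal J = J := by
  have hmon : ∀ a : Fin n →₀ ℕ, a ≠ 0 → monomial a (1 : k) ∈ J := by
    intro a ha
    obtain ⟨j, hj⟩ := Finsupp.ne_iff.1 ha
    exact hlast (monomial_mem_lastVariables j.rev.2 hj)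
  apply le_antisymm
  · refine Ideal.span_le.2 ?_
    rintro _ ⟨f', hf', a, ha', rfl⟩
    by_cases h0 : a = 0
    · subst h0
      obtain ⟨f, hf, hfd, ha⟩ := exists_homogeneous_of_mem_initialExponents hJ ⟨f', hf', ha'⟩
      rw [polyProj_eq_self_iff] at hfd
      have hC : f = C (coeff 0 f) := by
        ext b
        rw [coeff_C]
        split_ifs with hb
        · rw [hb]
        · by_contra hb'
          have := hfd b (mem_support_iff.2 hb')
          rw [map_zero, Nat.cast_zero, Nat.cast_eq_zero, Finsupp.degree_eq_zero_iff] at this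
          exact hb this.symm
      have h1 : C (coeff 0 f)⁻¹ * f ∈ J := J.mul_mem_left _ hf
      rw [hC, coeff_C, if_pos rfl, ← C_mul, inv_mul_cancel₀ (mem_support_iff.1 ha.1)] at h1
      exact h1
    · exact hmon a h0
  · intro f hf
    rw [mem_initialIdeal_iff]
    intro a ha
    by_cases h0 : a = 0
    · subst h0
      refine ⟨polyProj 0 f, polyProj_mem hJ 0 hf, mem_support_polyProj.2 ⟨by simp, ha⟩, ?_⟩
      intro b hb hne
      have := (mem_support_polyProj.1 hb).1
      rw [Nat.cast_eq_zero, Finsupp.degree_eq_zero_iff] at this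
      exact absurd this hne
    · exact mem_initialExponents_of_monomial_mem (hmon a h0)

end InitialExponents

/-! ### From filter-regularity to torsion colons -/

section FilterRegular

/-- If `𝔪` is the only associated prime of `M` containing `z`, then the elements killed by `z` are
torsion with respect to `𝔪`. -/
theorem exists_pow_smul_eq_zero_of_associatedPrimes {R M : Type*} [CommRing R] [IsNoetherianRing R]
    [AddCommGroup M] [Module R M] {𝔪 : Ideal R} {z : R}
    (hz : ∀ 𝔭 ∈ associatedPrimes R M, 𝔭 ≠ 𝔪 → z ∉ 𝔭) {y : M} (hy : z • y = 0) {x : R}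
    (hx : x ∈ 𝔪) : ∃ r : ℕ, x ^ r • y = 0 := by
  by_contra! hne
  let N : ℕ →o Ideal R :=
    ⟨fun r => LinearMap.ker (LinearMap.toSpanSingleton R M (x ^ r • y)), by
      refine monotone_nat_of_le_succ fun r a ha => ?_
      rw [LinearMap.mem_ker, LinearMap.toSpanSingleton_apply] at ha ⊢
      rw [pow_succ', mul_smul, smul_comm, ha, smul_zero]⟩
  -- At a stable stage r, choose an associated prime P = ann(a x^r y). It contains z, so P = 𝔪
  -- contains x; then a kills x^{r+1} y, by stability also x^r y, and P would be the unit ideal.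
  obtain ⟨r, hr⟩ := monotone_stabilizes_iff_noetherian.2 ‹IsNoetherianRing R› N
  let y' : Submodule.span R {x ^ r • y} := ⟨x ^ r • y, Submodule.mem_span_singleton_self _⟩
  have hy' : y' ≠ 0 := fun h => hne r (congrArg Subtype.val h)
  obtain ⟨P, hP, -⟩ := exists_le_isAssociatedPrime_of_isNoetherianRing R y' hy'
  have hPM : P ∈ associatedPrimes R M := associatedPrimes.subset_of_injective
    (f := (Submodule.span R {x ^ r • y}).subtype) Subtype.val_injective hP
  obtain ⟨hprime, ⟨w, hw⟩, hPw⟩ := isAssociatedPrime_iff.1 hP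
  obtain ⟨a, rfl⟩ := Submodule.mem_span_singleton.1 hw
  have hmem : ∀ b, b ∈ P ↔ b • a • x ^ r • y = 0 := by
    intro b
    rw [hPw, Submodule.mem_colon_singleton, Submodule.mem_bot, Subtype.ext_iff]
    rfl
  have hzP : z ∈ P := by
    rw [hmem, smul_comm z a, smul_comm z (x ^ r), hy, smul_zero, smul_zero]
  have hPm : P = 𝔪 := by
    by_contra h
    exact hz P hPM h hzP
  have hxP := (hmem x).1 (hPm ▸ hx)
  have ha : a ∈ N (r + 1) := by
    show a ∈ LinearMap.ker _
    rw [LinearMap.mem_ker, LinearMap.toSpanSingleton_apply, pow_succ', mul_smul, smul_comm a x,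
      hxP]
  rw [← hr (r + 1) (Nat.le_succ r)] at ha
  refine hprime.ne_top ((Ideal.eq_top_iff_one P).2 ((hmem 1).2 ?_))
  rw [one_smul]
  exact ha

variable {k : Type*} [Field k] {n : ℕ} {I : Ideal (MvPolynomial (Fin n) k)}

/-- The sequence runs backwards: its entry at `j.rev` is x_j, and the earlier entries generate the
image of `lastVariables k n j.rev`. -/
theorem isTorsionColon_of_isFilterRegular
    (h : IsFilterRegular (quotientMaximalIdeal I)
      (fun i : Fin n => Ideal.Quotient.mk I (X i.rev))) (j : Fin n) :
    IsTorsionColon (I ⊔ lastVariables k n j.rev) j := by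
  intro f hf i
  let K : Ideal (MvPolynomial (Fin n) k ⧸ I) :=
    Ideal.span ((fun i : Fin n => Ideal.Quotient.mk I (X i.rev)) '' {i | i < j.rev})
  have hK : K = (lastVariables k n j.rev).map (Ideal.Quotient.mk I) := by
    rw [lastVariables, Ideal.map_span, ← Set.image_comp]
    refine congrArg Ideal.span (Set.ext fun z => ?_)
    constructor
    · rintro ⟨l, hl, rfl⟩
      refine ⟨l.rev, ?_, rfl⟩
      show ((l.rev.rev : Fin n) : ℕ) < j.rev
      rw [Fin.rev_rev]
      exact hl
    · rintro ⟨l, hl, rfl⟩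
      exact ⟨l.rev, hl, by simp⟩
  have hmem : ∀ g, Ideal.Quotient.mk I g ∈ K ↔ g ∈ I ⊔ lastVariables k n j.rev := by
    intro g
    rw [hK, ← Ideal.mem_comap, Ideal.comap_map_of_surjective _ Ideal.Quotient.mk_surjective,
      ← RingHom.ker_eq_comap_bot, Ideal.mk_ker, sup_comm]
  have hass := h j.rev
  simp only [Fin.rev_rev] at hass
  obtain ⟨r, hr⟩ := exists_pow_smul_eq_zero_of_associatedPrimes (M := _ ⧸ K) hass
    (y := Ideal.Quotient.mk K (Ideal.Quotient.mk I f)) (x := Ideal.Quotient.mk I (X i)) (by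
      have : Ideal.Quotient.mk I (X j * f) ∈ K := (hmem _).2 hf
      exact Ideal.Quotient.eq_zero_iff_mem.2 this) (Ideal.subset_span ⟨i, rfl⟩)
  refine ⟨r, (hmem _).1 ?_⟩
  rw [map_mul, map_pow]
  exact Ideal.Quotient.eq_zero_iff_mem.1 hr

end FilterRegular

/-! ### Vanishing of top local cohomology of S/I for I ≠ 0 -/

section Top

variable {k : Type*} [Field k] {n : ℕ} {I : Ideal (MvPolynomial (Fin n) k)}

theorem monomial_mem_variableMonoid_univ (b : Fin n →₀ ℕ) :
    monomial b (1 : k) ∈ variableMonoid k (Finset.univ : Finset (Fin n)) := by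
  rw [monomial_eq, C_1, one_mul]
  exact Submonoid.prod_mem _ fun i _ => pow_mem (X_mem_variableMonoid (Finset.mem_univ i)) _

theorem exists_monomial_of_mem_variableMonoid {J : Finset (Fin n)} {s : MvPolynomial (Fin n) k}
    (hs : s ∈ variableMonoid k J) : ∃ b : Fin n →₀ ℕ, s = monomial b 1 := by
  induction hs using Submonoid.closure_induction with
  | mem x hx => obtain ⟨j, -, rfl⟩ := hx; exact ⟨_, rfl⟩
  | one => exact ⟨0, rfl⟩
  | mul x y _ _ hx hy =>
    obtain ⟨b, rfl⟩ := hx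
    obtain ⟨c, rfl⟩ := hy
    exact ⟨b + c, by rw [monomial_mul, one_mul]⟩

theorem monomial_mem_variableMonoid_erase {b : Fin n →₀ ℕ} {i : Fin n} (hb : b i = 0) :
    monomial b (1 : k) ∈ variableMonoid k (Finset.univ.erase i : Finset (Fin n)) := by
  rw [monomial_eq, C_1, one_mul]
  refine Submonoid.prod_mem _ fun j hj => pow_mem (X_mem_variableMonoid ?_) _
  refine Finset.mem_erase.2 ⟨?_, Finset.mem_univ j⟩
  rintro rfl
  exact Finsupp.mem_support_iff.1 hj hb

variable (I) in
/-- The fraction `x^a / x^b` in the localization of `S / I` at all variables. -/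
def monomialFraction (a b : Fin n →₀ ℕ) :
    LocalizationAt (k := k) (n := n) (MvPolynomial (Fin n) k ⧸ I) Finset.univ :=
  LocalizedModule.mk (Ideal.Quotient.mk I (monomial a 1))
    ⟨monomial b 1, monomial_mem_variableMonoid_univ b⟩

theorem monomialFraction_add_right (a b c : Fin n →₀ ℕ) :
    monomialFraction I (a + c) (b + c) = monomialFraction I a b := by
  refine LocalizedModule.mk_eq.2 ⟨1, ?_⟩
  rw [one_smul, one_smul, Submonoid.smul_def, Submonoid.smul_def]
  show Ideal.Quotient.mk I _ = Ideal.Quotient.mk I _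
  simp only [smul_eq_mul, monomial_mul, mul_one]
  congr 3
  rw [add_comm a c, ← add_assoc]

variable (I) in
/-- The sum of the images of the localizations of `S / I` at all variables but one. -/
def cechImage : Submodule (MvPolynomial (Fin n) k)
    (LocalizationAt (k := k) (n := n) (MvPolynomial (Fin n) k ⧸ I) Finset.univ) :=
  ⨆ i : Fin n, LinearMap.range
    (restriction (MvPolynomial (Fin n) k ⧸ I) (Finset.univ.erase_subset i))

/-- The variable x_i cancels from the denominator, so the fraction is defined without inverting it.
-/
theorem monomialFraction_mem_cechImage {a b : Fin n →₀ ℕ} {i : Fin n} (h : b i ≤ a i) :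
    monomialFraction I a b ∈ cechImage I := by
  have hb : b = b.erase i + Finsupp.single i (b i) := (Finsupp.erase_add_single i b).symm
  have ha : a = (a - Finsupp.single i (b i)) + Finsupp.single i (b i) :=
    (tsub_add_cancel_of_le (Finsupp.single_le_iff.2 h)).symm
  have key := monomialFraction_add_right (I := I) (a - Finsupp.single i (b i)) (b.erase i)
    (Finsupp.single i (b i))
  rw [← ha, ← hb] at key
  rw [key]
  refine Submodule.mem_iSup_of_mem i ⟨LocalizedModule.mk (Ideal.Quotient.mk I
    (monomial (a - Finsupp.single i (b i)) 1))
    ⟨monomial (b.erase i) 1, monomial_mem_variableMonoid_erase (by simp)⟩, ?_⟩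
  rw [restriction_mk]
  rfl

theorem smul_monomialFraction (c : k) (a b : Fin n →₀ ℕ) :
    (monomial a c : MvPolynomial (Fin n) k) • monomialFraction I 0 b =
      (C c : MvPolynomial (Fin n) k) • monomialFraction I a b := by
  rw [monomialFraction, monomialFraction, LocalizedModule.smul'_mk, LocalizedModule.smul'_mk]
  congr 1
  show Ideal.Quotient.mk I _ = Ideal.Quotient.mk I _
  simp [C_mul_monomial]

/-- A nonzero element of `I` allows to reduce the fractions `1 / x^b` modulo `cechImage I` to
lexicographically smaller ones, so that all of them vanish. -/
theorem monomialFraction_zero_mem_cechImage (hI : I ≠ ⊥) (b : Fin n →₀ ℕ) :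
    monomialFraction I 0 b ∈ cechImage I := by
  obtain ⟨f, hf, hf0⟩ := Submodule.exists_mem_ne_zero_of_ne_bot hI
  obtain ⟨a, ha, hmin⟩ := f.support.exists_min_image toLex (support_nonempty.2 hf0)
  induction hb : toLex b using WellFoundedLT.induction generalizing b with
  | _ l ih =>
  subst hb
  -- Since x^a is the lexicographically smallest monomial of f, this relation expresses x^a/x^{a+b}
  -- = 1/x^b through fractions x^c/x^{a+b} with c > a.
  have h0 : f • monomialFraction I 0 (a + b) = 0 := by
    rw [monomialFraction, LocalizedModule.smul'_mk]
    have : f • Ideal.Quotient.mk I (monomial 0 (1 : k)) = 0 :=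
      Ideal.Quotient.eq_zero_iff_mem.2 (I.mul_mem_right _ hf)
    rw [this, LocalizedModule.zero_mk]
  rw [f.as_sum, Finset.sum_smul, ← Finset.add_sum_erase _ _ ha] at h0
  simp only [smul_monomialFraction] at h0
  have hrest : ∑ c ∈ f.support.erase a,
      (C (coeff c f) : MvPolynomial (Fin n) k) • monomialFraction I c (a + b) ∈ cechImage I := by
    refine Submodule.sum_mem _ fun c hc => Submodule.smul_mem _ _ ?_
    obtain ⟨hca, hc⟩ := Finset.mem_erase.1 hc
    -- Either a variable cancels, or the fraction equals 1/x^{a+b-c} with a + b - c < b because a <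
    -- c.
    by_cases hle : ∃ i, (a + b) i ≤ c i
    · obtain ⟨i, hi⟩ := hle
      exact monomialFraction_mem_cechImage hi
    push Not at hle
    have hsub : (a + b - c) + c = a + b := tsub_add_cancel_of_le fun i => (hle i).le
    have hlt : toLex (a + b - c) < toLex b := by
      have hac : toLex a < toLex c :=
        lt_of_le_of_ne (hmin c hc) fun h => hca (toLex.injective h).symm
      by_contra! hge
      have := add_lt_add_of_le_of_lt hge hac
      rw [← toLex_add, ← toLex_add, hsub, add_comm a b] at this
      exact lt_irrefl _ this
    rw [← hsub]
    have := monomialFraction_add_right (I := I) 0 (a + b - c) c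
    rw [zero_add] at this
    rw [this]
    exact ih _ hlt _ rfl
  have h1 : (C (coeff a f) : MvPolynomial (Fin n) k) • monomialFraction I a (a + b) ∈
      cechImage I := by
    rw [eq_neg_of_add_eq_zero_left h0]
    exact neg_mem hrest
  have h2 := Submodule.smul_mem _ (C (coeff a f)⁻¹ : MvPolynomial (Fin n) k) h1
  rw [smul_smul, ← C_mul, inv_mul_cancel₀ (mem_support_iff.1 ha), C_1, one_smul, add_comm a b] at h2
  have := monomialFraction_add_right (I := I) 0 b a
  rw [zero_add] at this
  rwa [this] at h2

theorem cechImage_eq_top (hI : I ≠ ⊥) : cechImage I = ⊤ := by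
  rw [eq_top_iff]
  intro x _
  induction x using LocalizedModule.induction_on with
  | h m s =>
    obtain ⟨f, rfl⟩ := Ideal.Quotient.mk_surjective m
    obtain ⟨s, hs⟩ := s
    obtain ⟨b, rfl⟩ := exists_monomial_of_mem_variableMonoid hs
    have : (LocalizedModule.mk (Ideal.Quotient.mk I f) ⟨monomial b 1, hs⟩ :
        LocalizationAt (k := k) (n := n) (MvPolynomial (Fin n) k ⧸ I) Finset.univ) =
          f • monomialFraction I 0 b := by
      rw [monomialFraction, LocalizedModule.smul'_mk]
      congr 1
      show Ideal.Quotient.mk I _ = Ideal.Quotient.mk I (f * 1)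
      rw [mul_one]
    rw [this]
    exact Submodule.smul_mem _ _ (monomialFraction_zero_mem_cechImage hI b)

/-- The top local cohomology of `S / I` vanishes if `I ≠ 0`. -/
theorem nonvanishingDegrees_top (hI : I.IsHomogeneous (homogeneousSubmodule (Fin n) k))
    (hne : I ≠ ⊥) (d : ℤ) : d ∉ nonvanishingDegrees k n (quotientGrading I) n := by
  intro hd
  obtain ⟨φ, hφ, -, hb⟩ := (quotientProjections hI).mem_nonvanishingDegrees_iff.1 hd
  -- A cochain supported on the complement of {i} has its differential supported on the full set of
  -- variables, where it is a signed restriction.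
  have hrange : ∀ x ∈ cechImage I, ∃ ψ : CechModule (k := k) (n := n) _,
      cechDifferential (MvPolynomial (Fin n) k ⧸ I) ψ = Pi.single Finset.univ x := by
    intro x hx
    induction hx using Submodule.iSup_induction' with
    | mem i x hx =>
      obtain ⟨y, rfl⟩ := hx
      refine ⟨cechSign k Finset.univ i • Pi.single (Finset.univ.erase i) y, ?_⟩
      ext J
      rw [map_smul, Pi.smul_apply, cechDifferential_eq_sum]
      by_cases hJ : J = Finset.univ
      · subst hJ
        rw [Finset.sum_eq_single_of_mem i (Finset.mem_univ i), Pi.single_eq_same,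
          Pi.single_eq_same, smul_smul, cechSign_mul_self, one_smul]
        intro j _ hj
        rw [Pi.single_eq_of_ne, map_zero, smul_zero]
        intro h
        have : i ∈ Finset.univ.erase j := Finset.mem_erase.2 ⟨hj.symm, Finset.mem_univ i⟩
        rw [h] at this
        exact Finset.notMem_erase _ _ this
      · rw [Pi.single_eq_of_ne hJ, Finset.sum_eq_zero, smul_zero]
        intro j hj
        rw [Pi.single_eq_of_ne, map_zero, smul_zero]
        intro h
        apply hJ
        rw [← Finset.card_eq_iff_eq_univ, ← Finset.card_erase_add_one hj, h,
          Finset.card_erase_add_one (Finset.mem_univ i), Finset.card_univ]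
    | zero => exact ⟨0, by simp⟩
    | add x y _ _ hx hy =>
      obtain ⟨ψ, hψ⟩ := hx
      obtain ⟨χ, hχ⟩ := hy
      exact ⟨ψ + χ, by rw [map_add, hψ, hχ, Pi.single_add]⟩
  obtain ⟨ψ, hψ⟩ := hrange (φ Finset.univ) (cechImage_eq_top hne ▸ Submodule.mem_top)
  refine hb ψ (hψ.trans ?_)
  ext J
  by_cases hJ : J = Finset.univ
  · subst hJ; rw [Pi.single_eq_same]
  · rw [Pi.single_eq_of_ne hJ]
    refine (GradingProjections.apply_eq_zero hφ ?_).symm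
    intro h
    apply hJ
    rw [← Finset.card_eq_iff_eq_univ, Fintype.card_fin]
    exact_mod_cast h

end Top

/-! ### Passage to ideals and to the numerical invariants -/

section Comparison

variable {k : Type*} [Field k] {n : ℕ} {I I' : Ideal (MvPolynomial (Fin n) k)}

/-- Domination passes from the quotients `S / I` and `S / I'` to the ideals. -/
theorem Dominates.ideal {w : ℤ} (hI : I.IsHomogeneous (homogeneousSubmodule (Fin n) k))
    (hI' : I'.IsHomogeneous (homogeneousSubmodule (Fin n) k)) (hne : I ≠ ⊥) (hne' : I' ≠ ⊥)
    (h : Dominates w I I') (t i : ℕ) (hi : i ≤ t) (d : ℤ)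
    (hd : d ∈ nonvanishingDegrees k n (idealGrading I) i) :
    ∃ i' ≤ t, ∃ d' ∈ nonvanishingDegrees k n (idealGrading I') i', d + w * i ≤ d' + w * i' := by
  have hE := isAlmostShortExact_ideal hI
  have hE' := isAlmostShortExact_ideal hI'
  -- Cohomology of S occurs only for i = n, where H^n(S/I') = 0 makes H^n(I') → H^n(S) surjective.
  have hmid : ∀ i : ℕ, ∀ d ∈ nonvanishingDegrees k n
      (quotientGrading (⊥ : Ideal (MvPolynomial (Fin n) k))) i,
      d ∈ nonvanishingDegrees k n (idealGrading I') i := by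
    intro i d hd
    rcases hE'.mem_or_mem_of_mem_middle hd with hm | hm
    · rwa [sub_zero] at hm
    · have h1 := (quotientProjections isHomogeneous_bot).le_of_mem_nonvanishingDegrees hd
      have h2 := le_of_mem_nonvanishingDegrees_bot hd
      obtain rfl := le_antisymm h1 h2
      exact absurd hm (nonvanishingDegrees_top hI' hne' d)
  obtain _ | i := i
  · refine ⟨0, hi, d, hmid 0 d ?_, le_rfl⟩
    refine GradingProjections.nonvanishingDegrees_zero_subset (idealProjections hI)
      (quotientProjections isHomogeneous_bot) (f := Submodule.mkQ ⊥ ∘ₗ I.subtype) ?_ ?_ hd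
    · rw [← LinearMap.ker_eq_bot, LinearMap.ker_comp, Submodule.ker_mkQ]
      exact I.ker_subtype
    · intro e m
      simpa using hE.left e m
  · have hd' := hE.mem_or_mem_of_mem_left hd
    rw [add_zero] at hd'
    rcases hd' with hd' | hd'
    · exact ⟨i + 1, hi, d, hmid _ d hd', le_rfl⟩
    · obtain ⟨i', hi', d', hd'', hle⟩ := h (t - 1) i (by omega) d hd'
      rcases hE'.mem_or_mem_of_mem_right hd'' with hm | hm
      · have hn := le_of_mem_nonvanishingDegrees_bot hm
        have hn' := (quotientProjections hI').le_of_mem_nonvanishingDegrees hd''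
        obtain rfl := le_antisymm hn' hn
        exact absurd hd'' (nonvanishingDegrees_top hI' hne' d')
      · refine ⟨i' + 1, by omega, d', by simpa using hm, ?_⟩
        push_cast
        linarith

variable {A B : Type*} [AddCommGroup A] [Module (MvPolynomial (Fin n) k) A]
  [AddCommGroup B] [Module (MvPolynomial (Fin n) k) B]
  {𝓐 : ℕ → AddSubgroup A} {𝓑 : ℕ → AddSubgroup B}

/-- The finite shift c is moved to the other side before the supremum is bounded, which also covers
infinite values. -/
theorem aInvariant_add_le {i : ℕ} {c : ℤ} {v : WithBot (WithTop ℤ)}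
    (h : ∀ d ∈ nonvanishingDegrees k n 𝓐 i, (((d + c : ℤ) : WithTop ℤ) : WithBot (WithTop ℤ)) ≤ v) :
    aInvariant k n 𝓐 i + ((c : WithTop ℤ) : WithBot (WithTop ℤ)) ≤ v := by
  have hcancel : ∀ x y : ℤ, (((x + y : ℤ) : WithTop ℤ) : WithBot (WithTop ℤ)) =
      ((x : WithTop ℤ) : WithBot (WithTop ℤ)) + ((y : WithTop ℤ) : WithBot (WithTop ℤ)) :=
    fun _ _ => rfl
  have h0 : ((((0 : ℤ)) : WithTop ℤ) : WithBot (WithTop ℤ)) = 0 := rfl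
  have h1 : aInvariant k n 𝓐 i ≤ v + (((-c : ℤ) : WithTop ℤ) : WithBot (WithTop ℤ)) := by
    refine sSup_le ?_
    rintro _ ⟨d, hd, rfl⟩
    have := add_le_add_left (h d hd) (((-c : ℤ) : WithTop ℤ) : WithBot (WithTop ℤ))
    rwa [← hcancel, add_neg_cancel_right] at this
  have h2 := add_le_add_left h1 ((c : WithTop ℤ) : WithBot (WithTop ℤ))
  rwa [add_assoc, ← hcancel, neg_add_cancel, h0, add_zero] at h2

theorem le_aInvariant {i : ℕ} {d : ℤ} (hd : d ∈ nonvanishingDegrees k n 𝓐 i) :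
    ((d : WithTop ℤ) : WithBot (WithTop ℤ)) ≤ aInvariant k n 𝓐 i :=
  le_sSup ⟨d, hd, rfl⟩

theorem regT_le {t : ℕ} (h : ∀ i ≤ t, ∀ d ∈ nonvanishingDegrees k n 𝓐 i,
    ∃ i' ≤ t, ∃ d' ∈ nonvanishingDegrees k n 𝓑 i', d + 1 * (i : ℤ) ≤ d' + 1 * (i' : ℤ)) :
    regT k n 𝓐 t ≤ regT k n 𝓑 t := by
  refine Finset.sup_le fun i hi => aInvariant_add_le fun d hd => ?_
  obtain ⟨i', hi', d', hd', hle⟩ := h i (Nat.lt_succ_iff.1 (Finset.mem_range.1 hi)) d hd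
  refine le_trans ?_ (Finset.le_sup (f := fun i => aInvariant k n 𝓑 i +
    (((i : ℤ) : WithTop ℤ) : WithBot (WithTop ℤ))) (Finset.mem_range.2 (Nat.lt_succ_of_le hi')))
  refine le_trans ?_ (add_le_add_left (le_aInvariant hd') _)
  rw [one_mul, one_mul] at hle
  exact WithBot.coe_le_coe.2 (WithTop.coe_le_coe.2 hle)

theorem aStarT_le {t : ℕ} (h : ∀ i ≤ t, ∀ d ∈ nonvanishingDegrees k n 𝓐 i,
    ∃ i' ≤ t, ∃ d' ∈ nonvanishingDegrees k n 𝓑 i', d + 0 * (i : ℤ) ≤ d' + 0 * (i' : ℤ)) :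
    aStarT k n 𝓐 t ≤ aStarT k n 𝓑 t := by
  refine Finset.sup_le fun i hi => sSup_le ?_
  rintro _ ⟨d, hd, rfl⟩
  obtain ⟨i', hi', d', hd', hle⟩ := h i (Nat.lt_succ_iff.1 (Finset.mem_range.1 hi)) d hd
  refine le_trans ?_ (Finset.le_sup (f := fun i => aInvariant k n 𝓑 i)
    (Finset.mem_range.2 (Nat.lt_succ_of_le hi')))
  refine le_trans ?_ (le_aInvariant hd')
  rw [zero_mul, zero_mul, add_zero, add_zero] at hle
  exact WithBot.coe_le_coe.2 (WithTop.coe_le_coe.2 hle)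

/-- `S / I` and `S / in(I)` dominate each other. -/
theorem dominates_initialIdeal {w : ℤ} (hw : w ≤ 1)
    (hI : I.IsHomogeneous (homogeneousSubmodule (Fin n) k))
    (ht : ∀ j : Fin n, IsTorsionColon (I ⊔ lastVariables k n j.rev) j) :
    Dominates w I (initialIdeal I) ∧ Dominates w (initialIdeal I) I := by
  have hs := isHomogeneous_sup_lastVariables hI
  have ht' : ∀ j : Fin n, IsTorsionColon (initialIdeal I ⊔ lastVariables k n j.rev) j := by
    intro j
    rw [← initialIdeal_sup_lastVariables hI]
    exact (ht j).initialIdeal (hs _) le_sup_right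
  have hn : I ⊔ lastVariables k n n = initialIdeal I ⊔ lastVariables k n n := by
    rw [← initialIdeal_sup_lastVariables hI, initialIdeal_eq_self_of_le (hs n) le_sup_right]
  constructor
  · refine Dominates.of_colonDegrees hw hI isHomogeneous_initialIdeal ht ht' (fun j => ?_) hn
    rw [← initialIdeal_sup_lastVariables hI]
    exact colonDegrees_subset_initialIdeal (hs _)
  · refine Dominates.of_colonDegrees hw isHomogeneous_initialIdeal hI ht' ht (fun j => ?_) hn.symm
    rw [← initialIdeal_sup_lastVariables hI]
    exact colonDegrees_initialIdeal_subset (hs _) le_sup_right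

end Comparison

end GradedLocalCohomology

end

open GradedLocalCohomology in
theorem theorem1p3 {k : Type*} [Field k] {n : ℕ} (I : Ideal (MvPolynomial (Fin n) k))
    (hI : I.IsHomogeneous (MvPolynomial.homogeneousSubmodule (Fin n) k))
    (hreg : IsFilterRegular (quotientMaximalIdeal I)
      (fun i : Fin n => Ideal.Quotient.mk I (MvPolynomial.X i.rev)))
    (t : ℕ) :
    (regT k n (idealGrading I) t = regT k n (idealGrading (initialIdeal I)) t ∧
      aStarT k n (idealGrading I) t = aStarT k n (idealGrading (initialIdeal I)) t) ∧
    (regT k n (quotientGrading I) t = regT k n (quotientGrading (initialIdeal I)) t ∧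
      aStarT k n (quotientGrading I) t = aStarT k n (quotientGrading (initialIdeal I)) t) := by
  have ht := isTorsionColon_of_isFilterRegular hreg
  obtain ⟨h1, h1'⟩ := dominates_initialIdeal (w := 1) le_rfl hI ht
  obtain ⟨h0, h0'⟩ := dominates_initialIdeal (w := 0) zero_le_one hI ht
  refine ⟨?_, ⟨le_antisymm (regT_le (h1 t)) (regT_le (h1' t)),
    le_antisymm (aStarT_le (h0 t)) (aStarT_le (h0' t))⟩⟩
  -- For I = 0 the top cohomology of S/I need not vanish, so `Dominates.ideal` does not apply; but
  -- then in(I) = I.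
  by_cases hbot : I = ⊥
  · subst hbot
    rw [initialIdeal_bot]
    exact ⟨rfl, rfl⟩
  have hbot' := initialIdeal_ne_bot hbot
  have hin := isHomogeneous_initialIdeal (I := I)
  exact ⟨le_antisymm (regT_le (h1.ideal hI hin hbot hbot' t))
      (regT_le (h1'.ideal hin hI hbot' hbot t)),
    le_antisymm (aStarT_le (h0.ideal hI hin hbot hbot' t))
      (aStarT_le (h0'.ideal hin hI hbot' hbot t))⟩
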